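/- Identify the Euclidean plane with $\mathbb C$. Let $\alpha,\gamma\in\mathbb R$ and $C_0,C_1\in\mathbb C$, and let $\mathbf D$ be a line through $0$ directed by $e^{i\gamma}$. Let $\mathbf P_0$ be the open half-plane bounded by $\mathbf D$ that contains $ie^{i\gamma}$, and let $\mathbf P_1=\mathbb C\setminus\mathbf P_0$. The associated piecewise rotation $T:\mathbb C\to\mathbb C$ is given by $$T(z)=e^{i\alpha}(z-C_j)+C_j\quad\text{if } z\in\mathbf P_j,\ j\in\{0,1\}.$$ Put $|||T|||=\sup_{z\in\mathbb C}\big||T(z)|-|z|\big|$ (which is finite) and $\Delta=-2|C_1-C_0|\sin(\alpha/2)\cos(\gamma+\alpha/2-\beta)$, where $\beta=\arg(C_1-C_0)$. Let $B(0,r)$ be the open ball of radius $r$ centred at $0$. The map $T$ is *globally attractive* if there is $M\ge0$ such that $\limsup_{n\to\infty}\sup_{|z|\le L}|T^n(z)|\le M$ for all $L\ge0$, and *globally repulsive* if there is $M\ge0$ such that $\liminf_{n\to\infty}\inf_{|z|\ge L}|T^n(z)|=+\infty$ for all $L\ge M$. Let $M(T)\in[0,\infty]$ be the infimum of all $M\ge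 0$ with one of these two properties ($M(T)=\infty$ if there are none). Let $$\mathbf A(T)=\bigcup_{M>0}\bigcap_{n\ge0}T^n(B(0,M)),\qquad \mathbf B(T)=\bigcup_{M>0}\bigcap_{n\ge0}T^{-n}(B(0,M))$$ be the attractor of $T$ and the set of points with bounded orbit. **Theorem.** Suppose that $T$ is not bijective and that $\alpha=2\pi a$ with $a$ irrational. Let $(q_\ell)_{\ell\ge0}$ be the denominators of the convergents of the continued fraction of $a$ (so $q_0=1$), and let $\ell_0\ge0$ be any index such that $$\frac1{q_{\ell_0}}\left(\left(8+\frac{\pi}{2q_{\ell_0}}\right)|||T|||+4|\Delta|\right)<\frac{|\Delta|}{\pi}.$$ Then $$M(T)\le R:=q_{\ell_0}\,|||T|||\left(\frac2\pi q_{\ell_0}+1\right).$$ Moreover, if $\Delta>0$, then $T$ is globally attractive and $\mathbf A(T)\subset B(0,R)$; if $\Delta<0$, then $T$ is globally repulsive and $\mathbf B(T)\subset B(0,R)$. -/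

import Mathlib

open Filter Set
open scoped NNReal ENNReal

noncomputable section

/-- The line `D` through `z₀` directed by `e^{iγ}`. -/
def discontinuityLine (γ : ℝ) (z₀ : ℂ) : Set ℂ :=
  {z | ((z - z₀) * Complex.exp (-(γ : ℂ) * Complex.I)).im = 0}

/-- The open half-plane `P₀` bounded by `D`, the one that contains `z₀ + i e^{iγ}`. -/
def halfPlaneZero (γ : ℝ) (z₀ : ℂ) : Set ℂ :=
  {z | 0 < ((z - z₀) * Complex.exp (-(γ : ℂ) * Complex.I)).im}

/-- The rotation of angle `α` and centre `C`. -/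
def planeRotation (α : ℝ) (C z : ℂ) : ℂ :=
  Complex.exp ((α : ℂ) * Complex.I) * (z - C) + C

open Classical in
/-- The piecewise rotation of angle `α`, with discontinuity line through `z₀` directed by `e^{iγ}`:
the rotation about `C₀` on the open half-plane `P₀`, the rotation about `C₁` on the complementary
closed half-plane `P₁`. -/
def piecewiseRotation (α γ : ℝ) (z₀ C₀ C₁ : ℂ) (z : ℂ) : ℂ :=
  if z ∈ halfPlaneZero γ z₀ then planeRotation α C₀ z else planeRotation α C₁ z

/-- `Δ = -2 |C₁ - C₀| sin(α/2) cos(γ + α/2 - β)` with `β = arg (C₁ - C₀)`. -/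
def rotationDelta (α γ : ℝ) (C₀ C₁ : ℂ) : ℝ :=
  -2 * ‖C₁ - C₀‖ * Real.sin (α / 2) * Real.cos (γ + α / 2 - Complex.arg (C₁ - C₀))

/-- `|||T||| = sup_z | |T z| - |z| |`, as a real number. The supremum is finite for every
piecewise rotation, see `bddAbove_piecewiseRotation`. -/
def tripleNorm (T : ℂ → ℂ) : ℝ := ⨆ z : ℂ, |‖T z‖ - ‖z‖|

theorem abs_norm_planeRotation_sub_le (α : ℝ) (C z : ℂ) :
    |‖planeRotation α C z‖ - ‖z‖| ≤ 2 * ‖C‖ := by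
  have h1 : ‖Complex.exp ((α : ℂ) * Complex.I)‖ = 1 := Complex.norm_exp_ofReal_mul_I α
  have h2 : ‖Complex.exp ((α : ℂ) * Complex.I) * z‖ = ‖z‖ := by rw [norm_mul, h1, one_mul]
  calc |‖planeRotation α C z‖ - ‖z‖|
      = |‖planeRotation α C z‖ - ‖Complex.exp ((α : ℂ) * Complex.I) * z‖| := by rw [h2]
    _ ≤ ‖planeRotation α C z - Complex.exp ((α : ℂ) * Complex.I) * z‖ :=
        abs_norm_sub_norm_le _ _
    _ = ‖C - Complex.exp ((α : ℂ) * Complex.I) * C‖ := by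
        congr 1; unfold planeRotation; ring
    _ ≤ ‖C‖ + ‖Complex.exp ((α : ℂ) * Complex.I) * C‖ := norm_sub_le _ _
    _ = 2 * ‖C‖ := by rw [norm_mul, h1]; ring

theorem bddAbove_piecewiseRotation (α γ : ℝ) (z₀ C₀ C₁ : ℂ) :
    BddAbove (range fun z : ℂ => |‖piecewiseRotation α γ z₀ C₀ C₁ z‖ - ‖z‖|) := by
  refine ⟨max (2 * ‖C₀‖) (2 * ‖C₁‖), ?_⟩
  rintro _ ⟨z, rfl⟩
  by_cases hz : z ∈ halfPlaneZero γ z₀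
  · simp only [piecewiseRotation, if_pos hz]
    exact (abs_norm_planeRotation_sub_le α C₀ z).trans (le_max_left _ _)
  · simp only [piecewiseRotation, if_neg hz]
    exact (abs_norm_planeRotation_sub_le α C₁ z).trans (le_max_right _ _)

/-- `Attr(T) = ⋃_{M > 0} ⋂_{n ≥ 0} Tⁿ(B(0, M))`. -/
def attractorSet (T : ℂ → ℂ) : Set ℂ :=
  ⋃ (M : ℝ) (_ : 0 < M), ⋂ n : ℕ, T^[n] '' Metric.ball 0 M

/-- `Born(T) = ⋃_{M > 0} ⋂_{n ≥ 0} T⁻ⁿ(B(0, M))`, the set of points with bounded orbit. -/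
def boundedOrbitSet (T : ℂ → ℂ) : Set ℂ :=
  ⋃ (M : ℝ) (_ : 0 < M), ⋂ n : ℕ, T^[n] ⁻¹' Metric.ball 0 M

/-- For every `L ≥ 0`, `limsup_n sup_{|z| ≤ L} |Tⁿ z| ≤ M`. -/
def IsAttractingRadius (T : ℂ → ℂ) (M : ℝ≥0) : Prop :=
  ∀ L : ℝ≥0, limsup (fun n : ℕ => ⨆ (z : ℂ) (_ : ‖z‖ ≤ L), ‖T^[n] z‖ₑ) atTop ≤ (M : ℝ≥0∞)

/-- For every `L ≥ M`, `liminf_n inf_{|z| ≥ L} |Tⁿ z| = +∞`. -/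
def IsRepellingRadius (T : ℂ → ℂ) (M : ℝ≥0) : Prop :=
  ∀ L : ℝ≥0, M ≤ L →
    liminf (fun n : ℕ => ⨅ (z : ℂ) (_ : (L : ℝ) ≤ ‖z‖), ‖T^[n] z‖ₑ) atTop = (⊤ : ℝ≥0∞)

def GloballyAttractive (T : ℂ → ℂ) : Prop := ∃ M : ℝ≥0, IsAttractingRadius T M

def GloballyRepulsive (T : ℂ → ℂ) : Prop := ∃ M : ℝ≥0, IsRepellingRadius T M

/-- `M(T)`: the infimum of the `M ≥ 0` that witness global attraction or global repulsion of `T`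
(no map has witnesses of both kinds); it is `∞` if there are none. -/
def limitRadius (T : ℂ → ℂ) : ℝ≥0∞ :=
  ⨅ (M : ℝ≥0) (_ : IsAttractingRadius T M ∨ IsRepellingRadius T M), (M : ℝ≥0∞)

/-- The denominator `q_ℓ` of the `ℓ`-th convergent of the continued fraction of `a`. -/
def convergentDenom (a : ℝ) (l : ℕ) : ℝ := (GenContFract.of a).dens l

/-- The radius `q |||T||| ((2/π) q + 1)`. -/
def boundRadius (T : ℂ → ℂ) (q : ℝ) : ℝ :=
  q * tripleNorm T * (2 / Real.pi * q + 1)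

end

/-! Write N = |||T|||, v_j = e^{-iγ}(e^{-iα} - 1)C_j, and let ψ be the polar angle measured from D.
Far from 0, one step of T turns ψ by almost α and changes the norm by almost Re(e^{-iψ} v_j), which
is `sectorWave` at ψ. The mean of this wave over a period is Im(v₀ - v₁)/π = -Δ/π. Let p/q be the
chosen convergent. Starting at norm at least ρ = (2/π)q²N, the angles of q successive points stay
close to an orbit of the rotation by 2πp/q, that is, to a regular q-gon. Hence the norm changes over
q steps by -qΔ/π, with error at most (8 + π/(2q))N + |Δ| (`abs_norm_iterate_sub_add_le`). The
hypothesis makes the main term win: outside radius ρ, T^q moves the norm by at least a fixed ε,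
inward if Δ > 0 and outward if Δ < 0 (`exists_pos_drift`). Within q steps the norm varies by at most
qN, whence R = ρ + qN. -/

/-! ### Convergents of an irrational number -/

/-- The determinant of consecutive continuants changes sign at each step, so it stays a unit; this
gives coprimality of p and q. -/
theorem GenContFract.exists_int_contsAux_of_irrational {a : ℝ} (ha : Irrational a) (n : ℕ) :
    ∃ A B A' B' : ℤ, ((GenContFract.of a).contsAux n).a = A ∧ ((GenContFract.of a).contsAux n).b = B ∧
      ((GenContFract.of a).contsAux (n + 1)).a = A' ∧
      ((GenContFract.of a).contsAux (n + 1)).b = B' ∧ IsUnit (A * B' - B * A') := by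
  induction n with
  | zero => exact ⟨1, 0, ⌊a⌋, 1, by simp [GenContFract.contsAux]⟩
  | succ n ih =>
    obtain ⟨A, B, A', B', h1, h2, h3, h4, h5⟩ := ih
    have hnt : ¬ (GenContFract.of a).TerminatedAt n := by
      intro h
      obtain ⟨r, hr⟩ := (GenContFract.terminates_iff_rat a).1 ⟨n, h⟩
      exact ha ⟨r, hr.symm⟩
    obtain ⟨gp, hgp⟩ : ∃ gp, (GenContFract.of a).s.get? n = some gp :=
      Option.ne_none_iff_exists'.1 hnt
    obtain ⟨hgpa, d, hd⟩ := GenContFract.of_partNum_eq_one_and_exists_int_partDen_eq hgp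
    have hrec := GenContFract.contsAux_recurrence hgp rfl rfl
    refine ⟨A', B', d * A' + A, d * B' + B, h3, h4, ?_, ?_, ?_⟩
    · rw [hrec, hgpa, hd, h1, h3]; push_cast; ring
    · rw [hrec, hgpa, hd, h2, h4]; push_cast; ring
    · have : A' * (d * B' + B) - B' * (d * A' + A) = -(A * B' - B * A') := by ring
      rw [this]; exact h5.neg

/-- The convergents of an irrational number are reduced fractions `p / q` at distance at most
`1 / q ^ 2`. -/
theorem exists_coprime_convergentDenom {a : ℝ} (ha : Irrational a) (l : ℕ) :
    ∃ (p : ℤ) (q : ℕ), 0 < q ∧ IsCoprime p (q : ℤ) ∧ convergentDenom a l = q ∧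
      |a - p / q| ≤ 1 / (q : ℝ) ^ 2 := by
  have hnt : ∀ n, ¬ (GenContFract.of a).TerminatedAt n := by
    intro n h
    obtain ⟨r, hr⟩ := (GenContFract.terminates_iff_rat a).1 ⟨n, h⟩
    exact ha ⟨r, hr.symm⟩
  obtain ⟨A, B, A', B', -, -, h3, h4, h5⟩ := GenContFract.exists_int_contsAux_of_irrational ha l
  have hden : (GenContFract.of a).dens l = B' := h4
  have hnum : (GenContFract.of a).nums l = A' := h3
  have hpos : (1 : ℝ) ≤ (GenContFract.of a).dens l := by
    have h := GenContFract.succ_nth_fib_le_of_nth_den (v := a) (n := l) (Or.inr (hnt _))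
    refine le_trans ?_ h
    exact_mod_cast Nat.fib_pos.2 l.succ_pos
  have hB' : 0 < B' := by
    rw [hden] at hpos
    have : (0 : ℝ) < B' := by linarith
    exact_mod_cast this
  lift B' to ℕ using hB'.le
  have hden' : (GenContFract.of a).dens l = (B' : ℝ) := by rw [hden]; simp
  refine ⟨A', B', by exact_mod_cast hB', ?_, hden', ?_⟩
  · obtain ⟨u, hu⟩ := h5
    refine ⟨-B * ↑u⁻¹, A * ↑u⁻¹, ?_⟩
    have : (u : ℤ) * ↑u⁻¹ = 1 := by simp
    rw [← this, hu]; ring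
  · have h := GenContFract.abs_sub_convs_le (hnt l)
    rw [GenContFract.conv_eq_num_div_den, hnum, hden'] at h
    refine h.trans ?_
    have hm := GenContFract.of_den_mono (v := a) (n := l)
    rw [hden'] at hm hpos
    rw [sq]
    apply one_div_le_one_div_of_le (by positivity)
    gcongr

/-! ### The first-order radial increment and its jumps -/

/-- The `2π`-periodic function equal to `Re (e^{-ix} v₀)` where `sin x > 0` and to
`Re (e^{-ix} v₁)` elsewhere. -/
noncomputable def sectorWave (v₀ v₁ : ℂ) (x : ℝ) : ℝ :=
  if 0 < Real.sin x then Real.cos x * v₀.re + Real.sin x * v₀.im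
  else Real.cos x * v₁.re + Real.sin x * v₁.im

theorem sectorWave_periodic (v₀ v₁ : ℂ) : Function.Periodic (sectorWave v₀ v₁) (2 * Real.pi) := by
  intro x
  simp only [sectorWave, Real.sin_add_two_pi, Real.cos_add_two_pi]

/-- The sinusoid is Re(e^{-ix} v), and a chord of the unit circle is no longer than its arc. -/
theorem abs_sinusoid_sub_le {N : ℝ} {v : ℂ} (hv : ‖v‖ ≤ N) (x y : ℝ) :
    |(Real.cos y * v.re + Real.sin y * v.im) - (Real.cos x * v.re + Real.sin x * v.im)|
      ≤ N * |y - x| := by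
  have h1 : (Real.cos y * v.re + Real.sin y * v.im) - (Real.cos x * v.re + Real.sin x * v.im)
      = (Complex.exp (-x * Complex.I) * (Complex.exp (Complex.I * ((x - y : ℝ) : ℂ)) - 1) * v).re := by
    have : Complex.exp (-x * Complex.I) * (Complex.exp (Complex.I * ((x - y : ℝ) : ℂ)) - 1)
        = Complex.exp (((-y : ℝ) : ℂ) * Complex.I) - Complex.exp (((-x : ℝ) : ℂ) * Complex.I) := by
      rw [mul_sub, ← Complex.exp_add, mul_one]
      congr 2 <;> push_cast <;> ring
    rw [this]
    simp only [Complex.mul_re, Complex.sub_re, Complex.sub_im, Complex.exp_ofReal_mul_I_re,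
      Complex.exp_ofReal_mul_I_im, Real.cos_neg, Real.sin_neg]
    ring
  rw [h1]
  refine (Complex.abs_re_le_norm _).trans ?_
  have h2 : ‖Complex.exp (-x * Complex.I)‖ = 1 := by
    have := Complex.norm_exp_ofReal_mul_I (-x)
    simpa using this
  rw [norm_mul, norm_mul, h2, one_mul, mul_comm]
  have h3 := Real.norm_exp_I_mul_ofReal_sub_one_le (x := x - y)
  rw [Real.norm_eq_abs, abs_sub_comm] at h3
  exact mul_le_mul hv h3 (norm_nonneg _) ((norm_nonneg _).trans hv)

theorem exists_sin_eq_zero_mem_Icc {x y : ℝ} (hxy : x ≤ y)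
    (h : ¬ (0 < Real.sin x ↔ 0 < Real.sin y)) : ∃ t ∈ Icc x y, Real.sin t = 0 := by
  have hc : ContinuousOn Real.sin (Icc x y) := Real.continuous_sin.continuousOn
  by_cases hx : 0 < Real.sin x
  · have hy : Real.sin y ≤ 0 := by by_contra hy; push Not at hy; exact h ⟨fun _ => hy, fun _ => hx⟩
    obtain ⟨t, ht, h0⟩ := intermediate_value_Icc' hxy hc ⟨hy, hx.le⟩
    exact ⟨t, ht, h0⟩
  · have hy : 0 < Real.sin y := by by_contra hy; exact h ⟨fun h => absurd h hx, fun h => absurd h hy⟩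
    push Not at hx
    obtain ⟨t, ht, h0⟩ := intermediate_value_Icc hxy hc ⟨hx, hy.le⟩
    exact ⟨t, ht, h0⟩

/-- Between two nearby points the function `sectorWave` varies as a Lipschitz function, up to
one jump of height `Re (v₀ - v₁)`. -/
theorem sectorWave_sub_le_or {N : ℝ} {v₀ v₁ : ℂ} (h₀ : ‖v₀‖ ≤ N) (h₁ : ‖v₁‖ ≤ N) {x y : ℝ}
    (hxy : x ≤ y) (hy : y < x + Real.pi) :
    |sectorWave v₀ v₁ y - sectorWave v₀ v₁ x| ≤ N * (y - x) ∨
      ∃ t ∈ Icc x y, Real.sin t = 0 ∧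
        |sectorWave v₀ v₁ y - sectorWave v₀ v₁ x - (v₀ - v₁).re| ≤ N * (y - x) := by
  have hay : |y - x| = y - x := abs_of_nonneg (by linarith)
  by_cases h : 0 < Real.sin x ↔ 0 < Real.sin y
  · left
    rw [← hay]
    unfold sectorWave
    by_cases hx : 0 < Real.sin x
    · rw [if_pos hx, if_pos (h.1 hx)]; exact abs_sinusoid_sub_le h₀ x y
    · rw [if_neg hx, if_neg (fun h' => hx (h.2 h'))]; exact abs_sinusoid_sub_le h₁ x y
  · right
    obtain ⟨t, ht, h0⟩ := exists_sin_eq_zero_mem_Icc hxy h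
    refine ⟨t, ht, h0, ?_⟩
    have hcos : Real.cos t = 1 ∨ Real.cos t = -1 := by
      have := Real.sin_sq_add_cos_sq t
      rw [h0] at this
      exact mul_self_eq_one_iff.1 (by linarith [sq (Real.cos t)])
    have hxt : |t - x| = t - x := abs_of_nonneg (by linarith [ht.1])
    have hty : |y - t| = y - t := abs_of_nonneg (by linarith [ht.2])
    -- From left to right, an upward zero of sine passes from v₁ to v₀ with cos t = 1, a downward
    -- one from v₀ to v₁ with cos t = -1. The jump is Re(v₀ - v₁) in both cases.
    have key : ∀ v w : ℂ, ‖v‖ ≤ N → ‖w‖ ≤ N → Real.cos t * (w - v).re = (v₀ - v₁).re →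
        |(Real.cos y * w.re + Real.sin y * w.im) - (Real.cos x * v.re + Real.sin x * v.im)
          - (v₀ - v₁).re| ≤ N * (y - x) := by
      intro v w hv hw hvw
      have e1 := abs_sinusoid_sub_le hv x t
      have e2 := abs_sinusoid_sub_le hw t y
      rw [hxt] at e1
      rw [hty] at e2
      rw [h0] at e1 e2
      rw [← hvw, Complex.sub_re]
      rw [abs_le] at *
      constructor <;> nlinarith
    by_cases hx : 0 < Real.sin x
    · have hy' : ¬ 0 < Real.sin y := fun hy' => h ⟨fun _ => hy', fun _ => hx⟩
      have hlt : x < t := lt_of_le_of_ne ht.1 (by rintro rfl; linarith)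
      have hs : Real.sin x = - (Real.cos t * Real.sin (t - x)) := by
        have : x = t - (t - x) := by ring
        conv_lhs => rw [this, Real.sin_sub, h0]
        ring
      have hp : 0 < Real.sin (t - x) :=
        Real.sin_pos_of_pos_of_lt_pi (by linarith) (by linarith [ht.2])
      have hc : Real.cos t = -1 := by
        rcases hcos with h | h
        · rw [h] at hs; linarith
        · exact h
      simp only [sectorWave, if_pos hx, if_neg hy']
      exact key v₀ v₁ h₀ h₁ (by rw [hc]; simp)
    · have hy' : 0 < Real.sin y := by
        by_contra hy'; exact h ⟨fun h => absurd h hx, fun h => absurd h hy'⟩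
      have hlt : t < y := lt_of_le_of_ne ht.2 (by rintro rfl; linarith)
      have hs : Real.sin y = Real.cos t * Real.sin (y - t) := by
        have : y = t + (y - t) := by ring
        conv_lhs => rw [this, Real.sin_add, h0]
        ring
      have hp : 0 < Real.sin (y - t) :=
        Real.sin_pos_of_pos_of_lt_pi (by linarith) (by linarith [ht.1])
      have hc : Real.cos t = 1 := by
        rcases hcos with h | h
        · exact h
        · rw [h] at hs; linarith
      simp only [sectorWave, if_neg hx, if_pos hy']
      exact key v₁ v₀ h₁ h₀ (by rw [hc]; simp)

/-! ### Sums over orbits of a rational rotation -/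

theorem eq_of_dvd_sub_mul {p : ℤ} {q : ℕ} (hpq : IsCoprime p (q : ℤ)) {k k' : ℕ} (hk : k < q)
    (hk' : k' < q) (h : (q : ℤ) ∣ (k - k') * p) : k = k' := by
  have h1 : (q : ℤ) ∣ (k : ℤ) - k' := hpq.symm.dvd_of_dvd_mul_right h
  have h2 := Int.eq_zero_of_abs_lt_dvd h1 (by rw [abs_lt]; constructor <;> omega)
  omega

/-- The sum of a `2π`-periodic function over the orbit of a rotation of order `q` is its sum over
the regular grid of step `2π / q`. -/
theorem Function.Periodic.sum_rotation_eq {F : ℝ → ℝ} (hF : Function.Periodic F (2 * Real.pi))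
    {p : ℤ} {q : ℕ} (hq : 0 < q) (hpq : IsCoprime p (q : ℤ)) (b : ℤ) (c : ℝ) :
    ∑ k ∈ Finset.range q, F (c + 2 * Real.pi * ((k * p + b : ℤ) : ℝ) / q) =
      ∑ j ∈ Finset.range q, F (c + 2 * Real.pi * j / q) := by
  have hq' : (q : ℤ) ≠ 0 := by omega
  have hqr : (q : ℝ) ≠ 0 := by exact_mod_cast hq.ne'
  have hmaps : ∀ k ∈ Finset.range q, (((k : ℤ) * p + b) % q).toNat ∈ Finset.range q := by
    intro k _
    have h1 := Int.emod_nonneg ((k : ℤ) * p + b) hq'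
    have h2 := Int.emod_lt_of_pos ((k : ℤ) * p + b) (show (0 : ℤ) < q by omega)
    rw [Finset.mem_range]; omega
  have hinj : Set.InjOn (fun k : ℕ => (((k : ℤ) * p + b) % q).toNat) (Finset.range q) := by
    intro k hk k' hk' h
    simp only [Finset.coe_range, Set.mem_Iio] at hk hk'
    have h1 := Int.emod_nonneg ((k : ℤ) * p + b) hq'
    have h2 := Int.emod_nonneg ((k' : ℤ) * p + b) hq'
    have h3 : ((k : ℤ) * p + b) % q = ((k' : ℤ) * p + b) % q := by
      simp only at h; omega
    apply eq_of_dvd_sub_mul hpq hk hk'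
    have h4 := Int.ModEq.dvd (n := (q : ℤ)) (Eq.symm h3)
    convert h4 using 1; ring
  refine Finset.sum_nbij (fun k : ℕ => (((k : ℤ) * p + b) % q).toNat) hmaps hinj ?_ ?_
  · exact Finset.surjOn_of_injOn_of_card_le _ hmaps hinj le_rfl
  · intro k _
    have h1 := Int.emod_nonneg ((k : ℤ) * p + b) hq'
    have h2 : (((((k : ℤ) * p + b) % q).toNat : ℕ) : ℝ)
        = ((k * p + b : ℤ) : ℝ) - q * (((k * p + b) / q : ℤ) : ℝ) := by
      have e : ((((k : ℤ) * p + b) % q).toNat : ℤ) = (k * p + b) - q * ((k * p + b) / q) := by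
        rw [Int.toNat_of_nonneg h1, Int.emod_def]
      exact_mod_cast congrArg (Int.cast : ℤ → ℝ) e
    rw [h2, ← (hF.sub_int_mul_eq ((k * p + b) / q))]
    congr 1
    field_simp
    ring

/-- Telescoping, since 2 sin(h/2) cos x = sin(x + h/2) - sin(x - h/2). -/
theorem two_sin_mul_sum_cos (c h : ℝ) (n : ℕ) :
    2 * Real.sin (h / 2) * ∑ j ∈ Finset.range n, Real.cos (c + j * h) =
      Real.sin (c - h / 2 + n * h) - Real.sin (c - h / 2) := by
  induction n with
  | zero => simp
  | succ n ih =>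
    rw [Finset.sum_range_succ, mul_add, ih]
    have e1 : c - h / 2 + ((n + 1 : ℕ) : ℝ) * h = (c + n * h) + h / 2 := by push_cast; ring
    have e2 : c - h / 2 + n * h = (c + n * h) - h / 2 := by ring
    rw [e1, e2, Real.sin_add, Real.sin_sub (c + n * h)]; ring

theorem two_sin_mul_sum_sin (c h : ℝ) (n : ℕ) :
    2 * Real.sin (h / 2) * ∑ j ∈ Finset.range n, Real.sin (c + j * h) =
      Real.cos (c - h / 2) - Real.cos (c - h / 2 + n * h) := by
  induction n with
  | zero => simp
  | succ n ih =>
    rw [Finset.sum_range_succ, mul_add, ih]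
    have e1 : c - h / 2 + ((n + 1 : ℕ) : ℝ) * h = (c + n * h) + h / 2 := by push_cast; ring
    have e2 : c - h / 2 + n * h = (c + n * h) - h / 2 := by ring
    rw [e1, e2, Real.cos_add, Real.cos_sub (c + n * h)]; ring

/-- With y = π/q, this and `inv_sub_cot_le` place 1/sin y and cot y within 1 of q/π on the sides
needed to squeeze the sine sum over a half-turn. -/
theorem inv_sin_sub_inv_le {y : ℝ} (h0 : 0 < y) (h1 : y ≤ 1) :
    1 / Real.sin y - 1 / y ≤ 1 := by
  have hs := Real.sin_gt_sub_cube h0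
  have hy : y ^ 3 ≤ y ^ 2 := by nlinarith [sq_nonneg y]
  have hy2 : y ^ 2 ≤ y := by nlinarith
  have hs' : y / 2 < Real.sin y := by linarith
  have hpos : 0 < Real.sin y := by linarith
  rw [div_sub_div _ _ hpos.ne' h0.ne', div_le_one (by positivity)]
  nlinarith

theorem inv_sub_cot_le {y : ℝ} (h0 : 0 < y) (h1 : y ≤ 1) :
    1 / y - Real.cos y / Real.sin y ≤ 1 := by
  have hs := Real.sin_gt_sub_cube h0
  have hy : y ^ 3 ≤ y ^ 2 := by nlinarith [sq_nonneg y]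
  have hy2 : y ^ 2 ≤ y := by nlinarith
  have hs' : y / 2 < Real.sin y := by linarith
  have hpos : 0 < Real.sin y := by linarith
  have hlt := Real.sin_lt h0
  have hc := Real.one_sub_sq_div_two_le_cos (x := y)
  rw [div_sub_div _ _ h0.ne' hpos.ne', div_le_one (by positivity)]
  nlinarith

set_option maxHeartbeats 800000 in
/-- The sum of `sectorWave` over the grid of step `2π / q`, with offset in `(0, 2π / q]`. -/
theorem abs_sum_sectorWave_grid_sub_le_of_mem {q : ℕ} (hq : 4 ≤ q) (v₀ v₁ : ℂ) {c : ℝ}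
    (hc : c ∈ Ioc 0 (2 * Real.pi / q)) :
    |∑ j ∈ Finset.range q, sectorWave v₀ v₁ (c + 2 * Real.pi * j / q)
      - q / Real.pi * (v₀ - v₁).im| ≤ |(v₀ - v₁).re| + |(v₀ - v₁).im| := by
  have hpi := Real.pi_pos
  have hq0 : (0 : ℝ) < q := by exact_mod_cast (by omega : 0 < q)
  have hq4 : (4 : ℝ) ≤ q := by exact_mod_cast hq
  set h : ℝ := 2 * Real.pi / q with hh
  have hpos : 0 < h := by positivity
  have hqh : q * h = 2 * Real.pi := by rw [hh]; field_simp
  obtain ⟨hc0, hc1⟩ := hc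
  have hh2 : h / 2 ≤ 1 := by nlinarith [Real.pi_lt_four]
  have hgrid : ∀ j : ℕ, c + 2 * Real.pi * j / q = c + j * h := by intro j; rw [hh]; ring
  have hsin : 0 < Real.sin (h / 2) := Real.sin_pos_of_pos_of_lt_pi (by linarith) (by linarith [Real.pi_gt_three])
  set n := ⌈(Real.pi - c) / h⌉₊ with hn
  have hcpi : c ≤ Real.pi := by linarith [Real.pi_gt_three]
  have hnlt : ∀ j : ℕ, j < n ↔ c + j * h < Real.pi := by
    intro j
    rw [hn, Nat.lt_ceil, lt_div_iff₀ hpos]; constructor <;> intro <;> linarith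
  have hnq : n ≤ q := by
    rw [hn, Nat.ceil_le, div_le_iff₀ hpos]; linarith
  have hn1 : Real.pi - c ≤ n * h := by
    rw [← div_le_iff₀ hpos]; exact Nat.le_ceil _
  have hn2 : n * h < Real.pi - c + h := by
    have := Nat.ceil_lt_add_one (a := (Real.pi - c) / h) (div_nonneg (by linarith) hpos.le)
    rw [← hn] at this
    have h2 := mul_lt_mul_of_pos_right this hpos
    rw [add_mul, div_mul_cancel₀ _ hpos.ne'] at h2
    linarith
  set A := ∑ j ∈ Finset.range n, Real.cos (c + j * h) with hA
  set B := ∑ j ∈ Finset.range n, Real.sin (c + j * h) with hB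
  have hsum : ∑ j ∈ Finset.range q, sectorWave v₀ v₁ (c + 2 * Real.pi * j / q)
      = A * (v₀ - v₁).re + B * (v₀ - v₁).im := by
    -- The v₁ sinusoid is split off on the whole grid, where it sums to zero; only v₀ - v₁ on the n
    -- points of the upper half remains.
    have hwave : ∀ j ∈ Finset.range q, sectorWave v₀ v₁ (c + 2 * Real.pi * j / q) =
        (Real.cos (c + j * h) * v₁.re + Real.sin (c + j * h) * v₁.im) +
        if j < n then Real.cos (c + j * h) * (v₀ - v₁).re + Real.sin (c + j * h) * (v₀ - v₁).im
        else 0 := by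
      intro j hj
      rw [hgrid]
      have hjq : ((j : ℝ) + 1) * h ≤ q * h := by
        gcongr; exact_mod_cast Finset.mem_range.1 hj
      have hj0 : 0 ≤ (j : ℝ) * h := by positivity
      by_cases hjn : j < n
      · have hs : 0 < Real.sin (c + j * h) :=
          Real.sin_pos_of_pos_of_lt_pi (by linarith) ((hnlt j).1 hjn)
        rw [sectorWave, if_pos hs, if_pos hjn, Complex.sub_re, Complex.sub_im]; ring
      · have h1 : Real.pi ≤ c + j * h := by
          by_contra h1; push Not at h1; exact hjn ((hnlt j).2 h1)
        have hs : 0 ≤ Real.sin (c + j * h - Real.pi) :=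
          Real.sin_nonneg_of_nonneg_of_le_pi (by linarith) (by linarith)
        rw [Real.sin_sub_pi] at hs
        rw [sectorWave, if_neg (by linarith), if_neg hjn, add_zero]
    have hsum_cos : ∑ j ∈ Finset.range q, Real.cos (c + j * h) = 0 := by
      have := two_sin_mul_sum_cos c h q
      rw [hqh, Real.sin_add_two_pi, sub_self] at this
      exact (mul_eq_zero.1 this).resolve_left (by positivity)
    have hsum_sin : ∑ j ∈ Finset.range q, Real.sin (c + j * h) = 0 := by
      have := two_sin_mul_sum_sin c h q
      rw [hqh, Real.cos_add_two_pi, sub_self] at this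
      exact (mul_eq_zero.1 this).resolve_left (by positivity)
    rw [Finset.sum_congr rfl hwave, Finset.sum_add_distrib, Finset.sum_add_distrib,
      ← Finset.sum_mul, ← Finset.sum_mul, hsum_cos, hsum_sin, ← Finset.sum_filter]
    have hf : (Finset.range q).filter (· < n) = Finset.range n := by
      ext j; simp only [Finset.mem_filter, Finset.mem_range]; omega
    rw [hf, Finset.sum_add_distrib, ← Finset.sum_mul, ← Finset.sum_mul]
    ring
  -- After telescoping, the sums depend only on the end points `t` and `s + π`, which lie within h/2
  -- of 0 and π.
  set t := c - h / 2 with ht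
  set s := c - h / 2 + n * h - Real.pi with hs
  have hs' : c - h / 2 + n * h = s + Real.pi := by rw [hs]; ring
  have ht_abs : |t| ≤ h / 2 := by rw [abs_le]; constructor <;> linarith
  have hs_abs : |s| ≤ h / 2 := by rw [abs_le]; constructor <;> linarith
  have hAeq : 2 * Real.sin (h / 2) * A = - Real.sin s - Real.sin t := by
    rw [hA, two_sin_mul_sum_cos, hs', Real.sin_add_pi]
  have hBeq : 2 * Real.sin (h / 2) * B = Real.cos t + Real.cos s := by
    rw [hB, two_sin_mul_sum_sin, hs', Real.cos_add_pi]; ring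
  have hsin_le : ∀ x : ℝ, |x| ≤ h / 2 → |Real.sin x| ≤ Real.sin (h / 2) := by
    intro x hx
    obtain ⟨h1, h2⟩ := abs_le.1 hx
    rw [abs_le, ← Real.sin_neg]
    constructor <;> apply Real.sin_le_sin_of_le_of_le_pi_div_two <;> linarith [Real.pi_gt_three]
  have hcos_le : ∀ x : ℝ, |x| ≤ h / 2 → Real.cos (h / 2) ≤ Real.cos x := by
    intro x hx
    rw [← Real.cos_abs x]
    exact Real.cos_le_cos_of_nonneg_of_le_pi (abs_nonneg x) (by linarith [Real.pi_gt_three]) hx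
  clear_value h n A B s t
  have hA_le : |A| ≤ 1 := by
    have h1 := hsin_le s hs_abs
    have h2 := hsin_le t ht_abs
    rw [abs_le] at h1 h2 ⊢
    constructor <;> nlinarith
  have hB_le : |B - q / Real.pi| ≤ 1 := by
    have hq2 : (q : ℝ) / Real.pi = 1 / (h / 2) := by
      rw [div_eq_div_iff hpi.ne' (by positivity)]; linarith
    have h1 := hcos_le s hs_abs
    have h2 := hcos_le t ht_abs
    have h3 := Real.cos_le_one s
    have h4 := Real.cos_le_one t
    have h5 := inv_sin_sub_inv_le (by linarith : 0 < h / 2) hh2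
    have h6 := inv_sub_cot_le (by linarith : 0 < h / 2) hh2
    have h7 : B ≤ 1 / Real.sin (h / 2) := by rw [le_div_iff₀ hsin]; nlinarith
    have h8 : Real.cos (h / 2) / Real.sin (h / 2) ≤ B := by rw [div_le_iff₀ hsin]; nlinarith
    rw [hq2, abs_le]; constructor <;> linarith
  rw [hsum]
  have : A * (v₀ - v₁).re + B * (v₀ - v₁).im - q / Real.pi * (v₀ - v₁).im
      = A * (v₀ - v₁).re + (B - q / Real.pi) * (v₀ - v₁).im := by ring
  rw [this]
  refine (abs_add_le _ _).trans ?_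
  rw [abs_mul, abs_mul]
  gcongr
  · exact mul_le_of_le_one_left (abs_nonneg _) hA_le
  · exact mul_le_of_le_one_left (abs_nonneg _) hB_le

/-- The sum of `sectorWave` over an orbit of a rotation of order `q`. -/
theorem abs_sum_sectorWave_rotation_sub_le {p : ℤ} {q : ℕ} (hq : 4 ≤ q)
    (hpq : IsCoprime p (q : ℤ)) (v₀ v₁ : ℂ) (b : ℤ) (c : ℝ) :
    |∑ k ∈ Finset.range q, sectorWave v₀ v₁ (c + 2 * Real.pi * ((k * p + b : ℤ) : ℝ) / q)
      - q / Real.pi * (v₀ - v₁).im| ≤ |(v₀ - v₁).re| + |(v₀ - v₁).im| := by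
  have hq0 : (0 : ℝ) < q := by exact_mod_cast (by omega : 0 < q)
  have hstep : 0 < 2 * Real.pi / q := by positivity
  -- The offset is reduced to one grid step; the m steps are absorbed into b.
  obtain ⟨m, hm, -⟩ := existsUnique_add_zsmul_mem_Ioc hstep c 0
  rw [zero_add] at hm
  have hsum : ∑ k ∈ Finset.range q, sectorWave v₀ v₁ (c + 2 * Real.pi * ((k * p + b : ℤ) : ℝ) / q)
      = ∑ k ∈ Finset.range q, sectorWave v₀ v₁
        ((c + m • (2 * Real.pi / q)) + 2 * Real.pi * ((k * p + (b - m) : ℤ) : ℝ) / q) := by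
    refine Finset.sum_congr rfl fun k _ => ?_
    congr 1
    rw [zsmul_eq_mul]; push_cast; ring
  rw [hsum, (sectorWave_periodic v₀ v₁).sum_rotation_eq (by omega) hpq]
  exact abs_sum_sectorWave_grid_sub_le_of_mem hq v₀ v₁ hm

open Classical in
/-- At most one point of a rotation orbit of order `q` lies in a given arc of length less than
`2π / q`. -/
theorem card_rotation_mem_arc_le_one {p : ℤ} {q : ℕ} (hpq : IsCoprime p (q : ℤ)) (b : ℤ)
    (c u δ e : ℝ) (hδ : δ < 2 * Real.pi / q) :
    ((Finset.range q).filter fun k : ℕ => ∃ n : ℤ, 2 * Real.pi * n + e ∈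
      Icc (c + 2 * Real.pi * ((k * p + b : ℤ) : ℝ) / q + u)
        (c + 2 * Real.pi * ((k * p + b : ℤ) : ℝ) / q + u + δ)).card ≤ 1 := by
  rw [Finset.card_le_one]
  intro k hk k' hk'
  simp only [Finset.mem_filter, Finset.mem_range, mem_Icc] at hk hk'
  obtain ⟨hkq, n, h1, h2⟩ := hk
  obtain ⟨hkq', n', h1', h2'⟩ := hk'
  have hq0 : (0 : ℝ) < q := by exact_mod_cast (by omega : 0 < q)
  have hpi := Real.pi_pos
  -- Up to the factor 2π/q, this integer is a difference of two offsets in [-δ, 0], so it vanishes.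
  have key : |(((k : ℤ) - k') * p - q * (n - n') : ℤ)| < 1 := by
    have e1 : ((((k : ℤ) - k') * p - q * (n - n') : ℤ) : ℝ) =
        ((c + 2 * Real.pi * ((k * p + b : ℤ) : ℝ) / q + u - (2 * Real.pi * n + e))
          - (c + 2 * Real.pi * ((k' * p + b : ℤ) : ℝ) / q + u - (2 * Real.pi * n' + e)))
          / (2 * Real.pi / q) := by
      push_cast
      field_simp
      ring
    have e2 : |((((k : ℤ) - k') * p - q * (n - n') : ℤ) : ℝ)| < 1 := by
      rw [e1, abs_div, abs_of_pos (show 0 < 2 * Real.pi / q by positivity),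
        div_lt_one (by positivity), abs_lt]
      constructor <;> linarith
    exact_mod_cast e2
  rw [Int.abs_lt_one_iff] at key
  exact eq_of_dvd_sub_mul hpq hkq hkq' ⟨n - n', by linarith⟩

open Classical in
-- Modulo 2π the zeros of sine are 0 and π, and each accounts for at most one index.
theorem card_rotation_exists_sin_eq_zero_le_two {p : ℤ} {q : ℕ} (hpq : IsCoprime p (q : ℤ)) (b : ℤ)
    (c u δ : ℝ) (hδ : δ < 2 * Real.pi / q) :
    ((Finset.range q).filter fun k : ℕ => ∃ t ∈
      Icc (c + 2 * Real.pi * ((k * p + b : ℤ) : ℝ) / q + u)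
        (c + 2 * Real.pi * ((k * p + b : ℤ) : ℝ) / q + u + δ), Real.sin t = 0).card ≤ 2 := by
  have h0 := card_rotation_mem_arc_le_one hpq b c u δ 0 hδ
  have h1 := card_rotation_mem_arc_le_one hpq b c u δ Real.pi hδ
  refine (Finset.card_le_card ?_).trans ((Finset.card_union_le _ _).trans (add_le_add h0 h1))
  intro k hk
  rw [Finset.mem_filter] at hk
  obtain ⟨hkq, t, ht, hs⟩ := hk
  obtain ⟨n, rfl⟩ := Real.sin_eq_zero_iff.1 hs
  rw [Finset.mem_union, Finset.mem_filter, Finset.mem_filter]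
  rcases Int.even_or_odd' n with ⟨m, rfl | rfl⟩
  · left
    refine ⟨hkq, m, ?_⟩
    convert ht using 1; push_cast; ring
  · right
    refine ⟨hkq, m, ?_⟩
    convert ht using 1; push_cast; ring

/-- Comparing with the rational orbit from the middle index, not the first, halves the accumulated
angular error. -/
theorem sum_abs_sub_half_le (q : ℕ) :
    ∑ k ∈ Finset.range q, |(k : ℝ) - (q / 2 : ℕ)| ≤ (q : ℝ) ^ 2 / 4 := by
  have hid : ∀ n : ℕ, ∑ k ∈ Finset.range n, (k : ℝ) = n * (n - 1) / 2 := by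
    intro n
    induction n with
    | zero => simp
    | succ n ih => rw [Finset.sum_range_succ, ih]; push_cast; ring
  obtain ⟨m, m', hm, hm', hq⟩ : ∃ m m' : ℕ, q / 2 = m ∧ (m' = m ∨ m' = m + 1) ∧ q = m + m' :=
    ⟨q / 2, q - q / 2, rfl, by omega, by omega⟩
  rw [hm]
  rw [hq, Finset.sum_range_add]
  have e1 : ∑ k ∈ Finset.range m, |(k : ℝ) - m| = m * m - m * (m - 1) / 2 := by
    rw [← hid m]
    have : ∀ k ∈ Finset.range m, |(k : ℝ) - m| = m - k := by
      intro k hk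
      have : (k : ℝ) < m := by exact_mod_cast Finset.mem_range.1 hk
      rw [abs_sub_comm, abs_of_pos (by linarith)]
    rw [Finset.sum_congr rfl this, Finset.sum_sub_distrib]
    simp
  have e2 : ∑ k ∈ Finset.range m', |((m + k : ℕ) : ℝ) - m| = m' * (m' - 1) / 2 := by
    rw [← hid m']
    refine Finset.sum_congr rfl fun k _ => ?_
    push_cast
    rw [add_sub_cancel_left, abs_of_nonneg (by positivity)]
  rw [e1, e2]
  rcases hm' with rfl | rfl
  · push_cast; nlinarith
  · push_cast; nlinarith

/-- The sum of `sectorWave` over `q` points that remain close to an orbit of a rotation of order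
`q`. -/
theorem abs_sum_sectorWave_near_rotation_sub_le {p : ℤ} {q : ℕ} (hq : 4 ≤ q)
    (hpq : IsCoprime p (q : ℤ)) {N : ℝ} {v₀ v₁ : ℂ} (h₀ : ‖v₀‖ ≤ N) (h₁ : ‖v₁‖ ≤ N) (c : ℝ)
    (φ : ℕ → ℝ)
    (hφ : ∀ k < q, |φ k - (c + ((k : ℝ) - (q / 2 : ℕ)) * (2 * Real.pi * (p / q)))| ≤
      8 / (q : ℝ) ^ 2 * |(k : ℝ) - (q / 2 : ℕ)|) :
    |∑ k ∈ Finset.range q, sectorWave v₀ v₁ (φ k) - q / Real.pi * (v₀ - v₁).im| ≤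
      8 * N + |(v₀ - v₁).im| := by
  classical
  have hq0 : (0 : ℝ) < q := by exact_mod_cast (by omega : 0 < q)
  have hq4 : (4 : ℝ) ≤ q := by exact_mod_cast hq
  have hN : 0 ≤ N := (norm_nonneg _).trans h₀
  have hpi := Real.pi_gt_three
  set b : ℤ := -((q / 2 : ℕ) : ℤ) * p with hb
  set x : ℕ → ℝ := fun k => c + 2 * Real.pi * ((k * p + b : ℤ) : ℝ) / q with hx
  have hxk : ∀ k : ℕ, x k = c + ((k : ℝ) - (q / 2 : ℕ)) * (2 * Real.pi * (p / q)) := by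
    intro k; simp only [hx, hb]; generalize q / 2 = m; push_cast; ring
  have hδ : 4 / (q : ℝ) < 2 * Real.pi / q := by gcongr; linarith
  have hd : ∀ k < q, |φ k - x k| ≤ 8 / (q : ℝ) ^ 2 * |(k : ℝ) - (q / 2 : ℕ)| := by
    intro k hk; rw [hxk]; exact hφ k hk
  have hd4 : ∀ k < q, |φ k - x k| ≤ 4 / q := by
    intro k hk
    refine (hd k hk).trans ?_
    have hkq : |(k : ℝ) - (q / 2 : ℕ)| ≤ q / 2 := by
      have e1 : 2 * (k : ℝ) - 2 * (q / 2 : ℕ) ≤ q := by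
        have : 2 * k ≤ q + 2 * (q / 2) := by omega
        have : 2 * (k : ℝ) ≤ q + 2 * (q / 2 : ℕ) := by exact_mod_cast this
        linarith
      have e2 : 2 * ((q / 2 : ℕ) : ℝ) ≤ q := by
        have : 2 * (q / 2) ≤ q := by omega
        exact_mod_cast this
      have e3 : (0 : ℝ) ≤ k := by positivity
      rw [abs_le]; constructor <;> linarith
    calc 8 / (q : ℝ) ^ 2 * |(k : ℝ) - (q / 2 : ℕ)| ≤ 8 / (q : ℝ) ^ 2 * (q / 2) := by gcongr
      _ = 4 / (q : ℝ) := by field_simp; norm_num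
  have h4pi : 4 / (q : ℝ) < Real.pi := by
    rw [div_lt_iff₀ hq0]; nlinarith
  -- `j` counts the signed jump between x k and φ k: positive only for a zero of sine in the forward
  -- arc, negative only for one in the backward arc. Bounding each sign separately gives a total of
  -- at most 2 in absolute value, not 4.
  have hjump : ∀ k, ∃ j : ℝ, k < q →
      (|sectorWave v₀ v₁ (φ k) - sectorWave v₀ v₁ (x k) - j * (v₀ - v₁).re| ≤ N * |φ k - x k|) ∧
      (j ≤ if ∃ t ∈ Icc (x k + 0) (x k + 0 + 4 / q), Real.sin t = 0 then 1 else 0) ∧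
      (-j ≤ if ∃ t ∈ Icc (x k + -(4 / q)) (x k + -(4 / q) + 4 / q), Real.sin t = 0
        then 1 else 0) := by
    intro k
    by_cases hk : k < q
    swap
    · exact ⟨0, fun h => absurd h hk⟩
    have hdk := hd4 k hk
    have hite : ∀ P : Prop, (0 : ℝ) ≤ if P then 1 else 0 := by
      intro P; split_ifs <;> norm_num
    rcases le_total (x k) (φ k) with hle | hle
    · rw [abs_of_nonneg (by linarith)] at hdk ⊢
      rcases sectorWave_sub_le_or h₀ h₁ hle (by linarith) with h | ⟨t, ht, hs, h⟩
      · exact ⟨0, fun _ => ⟨by simpa using h, hite _, by simpa using hite _⟩⟩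
      · refine ⟨1, fun _ => ⟨by simpa using h, ?_, le_trans (by norm_num) (hite _)⟩⟩
        rw [if_pos ⟨t, ⟨by linarith [ht.1], by linarith [ht.2]⟩, hs⟩]
    · rw [abs_of_nonpos (by linarith)] at hdk ⊢
      rcases sectorWave_sub_le_or h₀ h₁ hle (by linarith) with h | ⟨t, ht, hs, h⟩
      · refine ⟨0, fun _ => ⟨?_, hite _, by simpa using hite _⟩⟩
        rw [abs_sub_comm] at h
        rw [zero_mul, sub_zero]; linarith
      · refine ⟨-1, fun _ => ⟨?_, le_trans (by norm_num) (hite _), ?_⟩⟩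
        · rw [← abs_neg]
          convert h using 1
          · congr 1; ring
          · ring
        · rw [if_pos ⟨t, ⟨by linarith [ht.1], by linarith [ht.2]⟩, hs⟩]; norm_num
  choose j hj using hjump
  have hsum_d : ∑ k ∈ Finset.range q, N * |φ k - x k| ≤ 2 * N := by
    rw [← Finset.mul_sum, mul_comm]
    gcongr
    calc ∑ k ∈ Finset.range q, |φ k - x k|
        ≤ ∑ k ∈ Finset.range q, 8 / (q : ℝ) ^ 2 * |(k : ℝ) - (q / 2 : ℕ)| :=
          Finset.sum_le_sum fun k hk => hd k (Finset.mem_range.1 hk)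
      _ = 8 / (q : ℝ) ^ 2 * ∑ k ∈ Finset.range q, |(k : ℝ) - (q / 2 : ℕ)| := by
          rw [Finset.mul_sum]
      _ ≤ 8 / (q : ℝ) ^ 2 * ((q : ℝ) ^ 2 / 4) := by gcongr; exact sum_abs_sub_half_le q
      _ = 2 := by field_simp; norm_num
  have hsum_j : |∑ k ∈ Finset.range q, j k| ≤ 2 := by
    have hc1 := card_rotation_exists_sin_eq_zero_le_two hpq b c 0 (4 / q) hδ
    have hc2 := card_rotation_exists_sin_eq_zero_le_two hpq b c (-(4 / q)) (4 / q) hδ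
    have hs1 := Finset.sum_le_sum fun k hk => (hj k (Finset.mem_range.1 hk)).2.1
    have hs2 := Finset.sum_le_sum fun k hk => (hj k (Finset.mem_range.1 hk)).2.2
    rw [← Finset.sum_filter, Finset.sum_const, nsmul_eq_mul, mul_one] at hs1 hs2
    rw [Finset.sum_neg_distrib] at hs2
    have hs1' := hs1.trans (show _ ≤ (2 : ℝ) by exact_mod_cast hc1)
    have hs2' := hs2.trans (show _ ≤ (2 : ℝ) by exact_mod_cast hc2)
    rw [abs_le]; constructor <;> linarith
  have hgrid := abs_sum_sectorWave_rotation_sub_le hq hpq v₀ v₁ b c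
  have hdiff : |∑ k ∈ Finset.range q, sectorWave v₀ v₁ (φ k)
      - ∑ k ∈ Finset.range q, sectorWave v₀ v₁ (x k) - (∑ k ∈ Finset.range q, j k) * (v₀ - v₁).re|
      ≤ 2 * N := by
    rw [← Finset.sum_sub_distrib, Finset.sum_mul, ← Finset.sum_sub_distrib]
    refine (Finset.abs_sum_le_sum_abs _ _).trans (le_trans ?_ hsum_d)
    exact Finset.sum_le_sum fun k hk => (hj k (Finset.mem_range.1 hk)).1
  have hV : |(v₀ - v₁).re| ≤ 2 * N :=
    (Complex.abs_re_le_norm _).trans ((norm_sub_le _ _).trans (by linarith))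
  have hjV : |(∑ k ∈ Finset.range q, j k) * (v₀ - v₁).re| ≤ 4 * N := by
    rw [abs_mul]
    calc _ ≤ 2 * (2 * N) := mul_le_mul hsum_j hV (abs_nonneg _) (by norm_num)
      _ = 4 * N := by ring
  -- Total: 2N (Lipschitz part), 4N (jumps) and 2N + |Im(v₀ - v₁)| (grid).
  rw [abs_le] at hgrid hdiff hjV ⊢
  constructor <;> linarith [hgrid.1, hgrid.2]

/-! ### Piecewise rotations in polar coordinates -/

theorem abs_norm_sub_norm_le_tripleNorm (α γ : ℝ) (z₀ C₀ C₁ z : ℂ) :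
    |‖piecewiseRotation α γ z₀ C₀ C₁ z‖ - ‖z‖| ≤ tripleNorm (piecewiseRotation α γ z₀ C₀ C₁) :=
  le_ciSup (bddAbove_piecewiseRotation α γ z₀ C₀ C₁) z

theorem mem_halfPlaneZero_iff {γ : ℝ} {z₀ : ℂ} (h : (0 : ℂ) ∈ discontinuityLine γ z₀) (z : ℂ) :
    z ∈ halfPlaneZero γ z₀ ↔ 0 < (z * Complex.exp (-(γ : ℂ) * Complex.I)).im := by
  simp only [discontinuityLine, mem_ofPred_eq, zero_sub, neg_mul, Complex.neg_im] at h
  simp only [halfPlaneZero, mem_ofPred_eq, sub_mul, Complex.sub_im, neg_mul] at h ⊢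
  constructor <;> intro <;> linarith

/-- The displacement coefficient of the rotation of angle `α` and centre `C`. -/
noncomputable def rotationCoeff (α : ℝ) (C : ℂ) : ℂ := (Complex.exp (-(α : ℂ) * Complex.I) - 1) * C

theorem planeRotation_eq (α : ℝ) (C z : ℂ) :
    planeRotation α C z = Complex.exp (α * Complex.I) * (z + rotationCoeff α C) := by
  have h : Complex.exp (α * Complex.I) * Complex.exp (-(α : ℂ) * Complex.I) = 1 := by
    rw [← Complex.exp_add]; simp
  unfold planeRotation rotationCoeff
  linear_combination (-C) * h

theorem norm_planeRotation (α : ℝ) (C z : ℂ) :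
    ‖planeRotation α C z‖ = ‖z + rotationCoeff α C‖ := by
  rw [planeRotation_eq, norm_mul, Complex.norm_exp_ofReal_mul_I, one_mul]

/-- If a translation changes norms by at most `N` on a closed half-plane then its vector has norm
at most `N`. -/
theorem norm_le_of_abs_norm_add_sub_norm_le {N : ℝ} {w e : ℂ}
    (h : ∀ z : ℂ, 0 ≤ (z * e).im → |‖z + w‖ - ‖z‖| ≤ N) : ‖w‖ ≤ N := by
  -- One of w, -w lies in the half-plane; their norms change by 2|w| - |w| and 0 - |w|.
  rcases le_total 0 (w * e).im with h0 | h0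
  · have := h w h0
    rw [← two_mul, norm_mul, Complex.norm_ofNat] at this
    linarith [(abs_le.1 this).2]
  · have := h (-w) (by rw [neg_mul, Complex.neg_im]; linarith)
    simpa using this

theorem norm_rotationCoeff_le_tripleNorm {α γ : ℝ} {z₀ : ℂ} (C₀ C₁ : ℂ)
    (h : (0 : ℂ) ∈ discontinuityLine γ z₀) :
    ‖rotationCoeff α C₀‖ ≤ tripleNorm (piecewiseRotation α γ z₀ C₀ C₁) ∧
      ‖rotationCoeff α C₁‖ ≤ tripleNorm (piecewiseRotation α γ z₀ C₀ C₁) := by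
  set N := tripleNorm (piecewiseRotation α γ z₀ C₀ C₁)
  have hT := abs_norm_sub_norm_le_tripleNorm α γ z₀ C₀ C₁
  have hγ : Complex.exp (γ * Complex.I) * Complex.exp (-(γ : ℂ) * Complex.I) = 1 := by
    rw [← Complex.exp_add]; simp
  constructor
  · apply norm_le_of_abs_norm_add_sub_norm_le (e := Complex.exp (-(γ : ℂ) * Complex.I))
    intro z hz
    -- P₀ is open: boundary points are reached as limits along the inner normal ie^{iγ}.
    have hpos : ∀ ε : ℝ, 0 < ε →
        |‖(z + ε * (Complex.I * Complex.exp (γ * Complex.I))) + rotationCoeff α C₀‖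
          - ‖z + ε * (Complex.I * Complex.exp (γ * Complex.I))‖| ≤ N := by
      intro ε hε
      have hmem : z + ε * (Complex.I * Complex.exp (γ * Complex.I)) ∈ halfPlaneZero γ z₀ := by
        rw [mem_halfPlaneZero_iff h]
        have : (z + ε * (Complex.I * Complex.exp (γ * Complex.I))) *
            Complex.exp (-(γ : ℂ) * Complex.I)
            = z * Complex.exp (-(γ : ℂ) * Complex.I) + ε * Complex.I := by
          linear_combination (ε * Complex.I) * hγ
        rw [this]
        simp only [Complex.add_im, Complex.mul_im, Complex.ofReal_re, Complex.I_im, Complex.ofReal_im,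
          Complex.I_re] at hz ⊢
        linarith
      have := hT (z + ε * (Complex.I * Complex.exp (γ * Complex.I)))
      rwa [piecewiseRotation, if_pos hmem, norm_planeRotation] at this
    have hlim : Tendsto (fun ε : ℝ =>
        |‖(z + ε * (Complex.I * Complex.exp (γ * Complex.I))) + rotationCoeff α C₀‖
          - ‖z + ε * (Complex.I * Complex.exp (γ * Complex.I))‖|) (nhdsWithin 0 (Ioi 0))
        (nhds |‖(z + (0 : ℝ) * (Complex.I * Complex.exp (γ * Complex.I))) + rotationCoeff α C₀‖
          - ‖z + (0 : ℝ) * (Complex.I * Complex.exp (γ * Complex.I))‖|) := by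
      apply Tendsto.mono_left _ nhdsWithin_le_nhds
      exact Continuous.tendsto (by fun_prop) 0
    have := le_of_tendsto hlim (by filter_upwards [self_mem_nhdsWithin] with ε hε using hpos ε hε)
    simpa using this
  · apply norm_le_of_abs_norm_add_sub_norm_le (e := -Complex.exp (-(γ : ℂ) * Complex.I))
    intro z hz
    have hmem : z ∉ halfPlaneZero γ z₀ := by
      rw [mem_halfPlaneZero_iff h]
      rw [mul_neg, Complex.neg_im] at hz
      linarith
    have := hT z
    rwa [piecewiseRotation, if_neg hmem, norm_planeRotation] at this

/-- This identifies the mean drift with -Δ/π; it rests on e^{-iα} - 1 = -2i sin(α/2) e^{-iα/2}. -/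
theorem im_rotationCoeff_sub (α γ : ℝ) (C₀ C₁ : ℂ) :
    (Complex.exp (-(γ : ℂ) * Complex.I) * rotationCoeff α C₀
      - Complex.exp (-(γ : ℂ) * Complex.I) * rotationCoeff α C₁).im = - rotationDelta α γ C₀ C₁ := by
  have h1 : Complex.exp (-(α : ℂ) * Complex.I) - 1
      = -2 * Complex.I * Real.sin (α / 2) * Complex.exp (((-(α / 2) : ℝ) : ℂ) * Complex.I) := by
    have e1 : -(α : ℂ) * Complex.I
        = ((-(α / 2) : ℝ) : ℂ) * Complex.I + ((-(α / 2) : ℝ) : ℂ) * Complex.I := by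
      push_cast; ring
    rw [e1, Complex.exp_add, Complex.exp_mul_I, ← Complex.ofReal_cos, ← Complex.ofReal_sin,
      Real.cos_neg, Real.sin_neg]
    have h := Real.sin_sq_add_cos_sq (α / 2)
    have h' : ((Real.sin (α / 2) : ℂ)) ^ 2 + (Real.cos (α / 2) : ℂ) ^ 2 = 1 := by exact_mod_cast h
    push_cast at h' ⊢
    linear_combination (1 : ℂ) * h' + (- Complex.sin (α / 2) ^ 2) * Complex.I_sq
  have h2 : Complex.exp (-(γ : ℂ) * Complex.I) * rotationCoeff α C₀
      - Complex.exp (-(γ : ℂ) * Complex.I) * rotationCoeff α C₁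
      = ((2 * Real.sin (α / 2) * ‖C₁ - C₀‖ : ℝ) : ℂ) * (Complex.I * Complex.exp
        ((((C₁ - C₀).arg - (γ + α / 2) : ℝ) : ℂ) * Complex.I)) := by
    have h3 := Complex.norm_mul_exp_arg_mul_I (C₁ - C₀)
    have h4 : Complex.exp ((((C₁ - C₀).arg - (γ + α / 2) : ℝ) : ℂ) * Complex.I)
        = Complex.exp ((C₁ - C₀).arg * Complex.I) * (Complex.exp (-(γ : ℂ) * Complex.I) *
          Complex.exp (((-(α / 2) : ℝ) : ℂ) * Complex.I)) := by
      rw [← Complex.exp_add, ← Complex.exp_add]; congr 1; push_cast; ring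
    rw [h4]
    unfold rotationCoeff
    rw [h1]
    push_cast
    linear_combination (-2 * Complex.sin (α / 2) * Complex.I * Complex.exp (-(γ : ℂ) * Complex.I) *
          Complex.exp ((-(α / 2) : ℂ) * Complex.I)) * h3
  rw [h2, Complex.im_ofReal_mul, Complex.I_mul_im, Complex.exp_ofReal_mul_I_re, rotationDelta,
    ← Real.cos_neg]
  rw [neg_sub]; ring

/-- The error equals (Im u)² / (|r + u| + r + Re u). -/
theorem abs_norm_ofReal_add_sub_le {r N : ℝ} {u : ℂ} (hu : ‖u‖ ≤ N) (hr : N < r) :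
    |‖(r : ℂ) + u‖ - r - u.re| ≤ N ^ 2 / (2 * (r - N)) := by
  have hre := abs_le.1 ((Complex.abs_re_le_norm u).trans hu)
  have him := abs_le.1 ((Complex.abs_im_le_norm u).trans hu)
  have hsq : ‖(r : ℂ) + u‖ ^ 2 = (r + u.re) ^ 2 + u.im ^ 2 := by
    rw [Complex.sq_norm, Complex.normSq_apply]; simp; ring
  set m := ‖(r : ℂ) + u‖
  have hm : r + u.re ≤ m := by
    have := Complex.re_le_norm ((r : ℂ) + u)
    simpa using this
  rw [abs_of_nonneg (by linarith), le_div_iff₀ (by linarith)]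
  have h1 : (m - r - u.re) * (m + (r + u.re)) = u.im ^ 2 := by linear_combination hsq
  have h2 : u.im ^ 2 ≤ N ^ 2 := sq_le_sq' him.1 him.2
  have h3 : (m - r - u.re) * (2 * (r - N)) ≤ (m - r - u.re) * (m + (r + u.re)) :=
    mul_le_mul_of_nonneg_left (by linarith) (by linarith)
  linarith

/-- The argument is the imaginary part of log(1 + u) = u + O(u²). -/
theorem Complex.abs_arg_one_add_le {u : ℂ} {x : ℝ} (hu : ‖u‖ ≤ x) (hx : x ≤ 1 / 2) :
    |(1 + u).arg| ≤ x + x ^ 2 := by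
  have h0 := norm_nonneg u
  have h1 := Complex.norm_log_one_add_le (z := u) (by linarith)
  have h2 := Complex.abs_im_le_norm (Complex.log (1 + u))
  rw [Complex.log_im] at h2
  have h3 : (1 - ‖u‖)⁻¹ ≤ 2 := by
    rw [inv_le_comm₀ (by linarith) (by norm_num)]; linarith
  have h4 : ‖u‖ ^ 2 * (1 - ‖u‖)⁻¹ / 2 ≤ ‖u‖ ^ 2 := by nlinarith [sq_nonneg ‖u‖]
  have h5 : ‖u‖ ^ 2 ≤ x ^ 2 := by gcongr
  linarith

/-- One step of a piecewise rotation in polar coordinates. -/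
theorem exists_angle_piecewiseRotation {α γ N : ℝ} {z₀ C₀ C₁ v₀ v₁ z : ℂ}
    (h : (0 : ℂ) ∈ discontinuityLine γ z₀)
    (hv₀ : v₀ = Complex.exp (-(γ : ℂ) * Complex.I) * rotationCoeff α C₀)
    (hv₁ : v₁ = Complex.exp (-(γ : ℂ) * Complex.I) * rotationCoeff α C₁)
    (h₀ : ‖v₀‖ ≤ N) (h₁ : ‖v₁‖ ≤ N) {ψ x : ℝ}
    (hz : z = ‖z‖ * Complex.exp (((ψ + γ : ℝ) : ℂ) * Complex.I)) (hzpos : 0 < ‖z‖)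
    (hx : N ≤ x * ‖z‖) (hx2 : x < 1 / 2) :
    ∃ ψ' : ℝ, piecewiseRotation α γ z₀ C₀ C₁ z = ‖piecewiseRotation α γ z₀ C₀ C₁ z‖ *
        Complex.exp (((ψ' + γ : ℝ) : ℂ) * Complex.I) ∧
      |ψ' - ψ - α| ≤ x + x ^ 2 ∧
      |‖piecewiseRotation α γ z₀ C₀ C₁ z‖ - ‖z‖ - sectorWave v₀ v₁ ψ| ≤
        N ^ 2 / (2 * (‖z‖ - N)) := by
  have key : ∀ C v : ℂ, v = Complex.exp (-(γ : ℂ) * Complex.I) * rotationCoeff α C → ‖v‖ ≤ N →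
      ∃ ψ' : ℝ, planeRotation α C z = ‖planeRotation α C z‖ *
        Complex.exp (((ψ' + γ : ℝ) : ℂ) * Complex.I) ∧ |ψ' - ψ - α| ≤ x + x ^ 2 ∧
      |‖planeRotation α C z‖ - ‖z‖ - (Real.cos ψ * v.re + Real.sin ψ * v.im)| ≤
        N ^ 2 / (2 * (‖z‖ - N)) := by
    intro C v hv hvN
    set u := Complex.exp (((-ψ : ℝ) : ℂ) * Complex.I) * v with hu
    have huN : ‖u‖ ≤ N := by rwa [hu, norm_mul, Complex.norm_exp_ofReal_mul_I, one_mul]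
    have hr : (‖z‖ : ℂ) ≠ 0 := by exact_mod_cast hzpos.ne'
    -- Both increments are read off |z| + u: its argument corrects the angle, its modulus is the new
    -- norm.
    have hfac : planeRotation α C z
        = Complex.exp (((α + ψ + γ : ℝ) : ℂ) * Complex.I) * ((‖z‖ : ℂ) + u) := by
      have e1 : Complex.exp (((α + ψ + γ : ℝ) : ℂ) * Complex.I)
          = Complex.exp (α * Complex.I) * Complex.exp (((ψ + γ : ℝ) : ℂ) * Complex.I) := by
        rw [← Complex.exp_add]; congr 1; push_cast; ring
      have e2 : Complex.exp (((ψ + γ : ℝ) : ℂ) * Complex.I) *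
          (Complex.exp (((-ψ : ℝ) : ℂ) * Complex.I) * Complex.exp (-(γ : ℂ) * Complex.I)) = 1 := by
        rw [← Complex.exp_add, ← Complex.exp_add, ← Complex.exp_zero]; congr 1; push_cast; ring
      rw [planeRotation_eq, e1, hu, hv]
      linear_combination Complex.exp (α * Complex.I) * hz
        - Complex.exp (α * Complex.I) * rotationCoeff α C * e2
    have hnorm : ‖planeRotation α C z‖ = ‖(‖z‖ : ℂ) + u‖ := by
      rw [hfac, norm_mul, Complex.norm_exp_ofReal_mul_I, one_mul]
    refine ⟨ψ + α + (1 + u / ‖z‖).arg, ?_, ?_, ?_⟩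
    · have e1 : (‖z‖ : ℂ) + u = ‖z‖ * (1 + u / ‖z‖) := by field_simp
      have e2 := Complex.norm_mul_exp_arg_mul_I (1 + u / ‖z‖)
      have e3 : ((ψ + α + (1 + u / ‖z‖).arg + γ : ℝ) : ℂ) * Complex.I
          = ((α + ψ + γ : ℝ) : ℂ) * Complex.I + (1 + u / ‖z‖).arg * Complex.I := by
        push_cast; ring
      rw [hnorm, e3, Complex.exp_add, hfac, e1, norm_mul, Complex.norm_real, norm_norm]
      push_cast
      linear_combination (-Complex.exp ((α + ψ + γ : ℂ) * Complex.I) * ‖z‖) * e2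
    · have : ψ + α + (1 + u / ‖z‖).arg - ψ - α = (1 + u / ‖z‖).arg := by ring
      rw [this]
      apply Complex.abs_arg_one_add_le _ hx2.le
      rw [norm_div, Complex.norm_real, norm_norm, div_le_iff₀ hzpos]
      exact huN.trans hx
    · have hre : u.re = Real.cos ψ * v.re + Real.sin ψ * v.im := by
        rw [hu, Complex.mul_re, Complex.exp_ofReal_mul_I_re, Complex.exp_ofReal_mul_I_im,
          Real.cos_neg, Real.sin_neg]
        ring
      rw [hnorm, ← hre]
      exact abs_norm_ofReal_add_sub_le huN (by nlinarith)
  have hmem : z ∈ halfPlaneZero γ z₀ ↔ 0 < Real.sin ψ := by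
    rw [mem_halfPlaneZero_iff h]
    have : z * Complex.exp (-(γ : ℂ) * Complex.I) = ‖z‖ * Complex.exp ((ψ : ℂ) * Complex.I) := by
      conv_lhs => rw [hz, mul_assoc, ← Complex.exp_add]
      congr 2; push_cast; ring
    rw [this, Complex.im_ofReal_mul, Complex.exp_ofReal_mul_I_im]
    exact mul_pos_iff_of_pos_left hzpos
  by_cases hs : 0 < Real.sin ψ
  · simp only [piecewiseRotation, if_pos (hmem.2 hs), sectorWave, if_pos hs]
    exact key C₀ v₀ hv₀ h₀
  · simp only [piecewiseRotation, if_neg (mt hmem.1 hs), sectorWave, if_neg hs]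
    exact key C₁ v₁ hv₁ h₁

theorem abs_sub_sub_mul_le_of_abs_succ_sub_le {s : ℕ → ℝ} {α η : ℝ} {n : ℕ}
    (h : ∀ k < n, |s (k + 1) - s k - α| ≤ η) {k m : ℕ} (hk : k ≤ n) (hm : m ≤ n) :
    |s k - s m - ((k : ℝ) - m) * α| ≤ η * |(k : ℝ) - m| := by
  have key : ∀ j i : ℕ, i + j ≤ n → |s (i + j) - s i - j * α| ≤ η * j := by
    intro j i
    induction j with
    | zero => intro; simp
    | succ j ih =>
      intro hij
      have h1 := ih (by omega)
      have h2 := h (i + j) (by omega)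
      rw [abs_le] at *
      push_cast
      rw [← add_assoc]
      constructor <;> nlinarith
  rcases le_total m k with hmk | hmk
  · obtain ⟨j, rfl⟩ := Nat.exists_eq_add_of_le hmk
    have := key j m hk
    push_cast
    rwa [add_sub_cancel_left, abs_of_nonneg (by positivity : (0 : ℝ) ≤ j)]
  · obtain ⟨j, rfl⟩ := Nat.exists_eq_add_of_le hmk
    have := key j k hm
    push_cast
    rw [sub_add_cancel_left, abs_neg, abs_of_nonneg (by positivity : (0 : ℝ) ≤ j), ← abs_neg]
    convert this using 2; ring

theorem abs_norm_iterate_sub_le (α γ : ℝ) (z₀ C₀ C₁ z : ℂ) (n : ℕ) :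
    |‖(piecewiseRotation α γ z₀ C₀ C₁)^[n] z‖ - ‖z‖| ≤
      n * tripleNorm (piecewiseRotation α γ z₀ C₀ C₁) := by
  induction n with
  | zero => simp
  | succ n ih =>
    rw [Function.iterate_succ_apply']
    have h := abs_norm_sub_norm_le_tripleNorm α γ z₀ C₀ C₁
      ((piecewiseRotation α γ z₀ C₀ C₁)^[n] z)
    rw [abs_le] at *
    push_cast
    constructor <;> linarith

theorem exists_angles_iterate {α γ N x : ℝ} {z₀ C₀ C₁ v₀ v₁ : ℂ}
    (h : (0 : ℂ) ∈ discontinuityLine γ z₀)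
    (hv₀ : v₀ = Complex.exp (-(γ : ℂ) * Complex.I) * rotationCoeff α C₀)
    (hv₁ : v₁ = Complex.exp (-(γ : ℂ) * Complex.I) * rotationCoeff α C₁)
    (h₀ : ‖v₀‖ ≤ N) (h₁ : ‖v₁‖ ≤ N) (hx2 : x < 1 / 2) {T : ℂ → ℂ}
    (hT : T = piecewiseRotation α γ z₀ C₀ C₁) (z : ℂ) (n : ℕ)
    (hpos : ∀ k < n, 0 < ‖T^[k] z‖) (hx : ∀ k < n, N ≤ x * ‖T^[k] z‖) :
    ∃ ψ : ℕ → ℝ, ∀ k < n, |ψ (k + 1) - ψ k - α| ≤ x + x ^ 2 ∧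
      |‖T^[k + 1] z‖ - ‖T^[k] z‖ - sectorWave v₀ v₁ (ψ k)| ≤ N ^ 2 / (2 * (‖T^[k] z‖ - N)) := by
  -- The conditions stand after the existential so that `choose` gives a total map to iterate. The
  -- angles are real lifts, not reduced modulo 2π.
  have hstep : ∀ (k : ℕ) (ψ : ℝ), ∃ ψ' : ℝ, k < n →
      T^[k] z = ‖T^[k] z‖ * Complex.exp (((ψ + γ : ℝ) : ℂ) * Complex.I) →
      (T^[k + 1] z = ‖T^[k + 1] z‖ * Complex.exp (((ψ' + γ : ℝ) : ℂ) * Complex.I) ∧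
      |ψ' - ψ - α| ≤ x + x ^ 2 ∧
      |‖T^[k + 1] z‖ - ‖T^[k] z‖ - sectorWave v₀ v₁ ψ| ≤ N ^ 2 / (2 * (‖T^[k] z‖ - N))) := by
    intro k ψ
    by_cases hc : k < n ∧
      T^[k] z = ‖T^[k] z‖ * Complex.exp (((ψ + γ : ℝ) : ℂ) * Complex.I)
    · obtain ⟨hk, hz⟩ := hc
      obtain ⟨ψ', h'⟩ := exists_angle_piecewiseRotation h hv₀ hv₁ h₀ h₁ hz (hpos k hk) (hx k hk) hx2
      refine ⟨ψ', fun _ _ => ?_⟩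
      rw [Function.iterate_succ_apply', hT] at *
      exact h'
    · exact ⟨0, fun h1 h2 => absurd ⟨h1, h2⟩ hc⟩
  choose g hg using hstep
  let ψ : ℕ → ℝ := fun k => Nat.rec (z.arg - γ) (fun k t => g k t) k
  have hpolar : ∀ k ≤ n,
      T^[k] z = ‖T^[k] z‖ * Complex.exp (((ψ k + γ : ℝ) : ℂ) * Complex.I) := by
    intro k
    induction k with
    | zero =>
      intro _
      have : ψ 0 + γ = z.arg := sub_add_cancel _ _
      rw [this]
      exact (Complex.norm_mul_exp_arg_mul_I z).symm
    | succ k ih => intro hk; exact (hg k (ψ k) (by omega) (ih (by omega))).1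
  exact ⟨ψ, fun k hk => (hg k (ψ k) hk (hpolar k hk.le)).2⟩

/-! ### Radial drift over q steps -/

/-- The drift of the norm along `q` iterations of a piecewise rotation, far from the origin, when
the angle is `1 / q ^ 2`-close to a reduced fraction `p / q` of a turn. -/
theorem abs_norm_iterate_sub_add_le {α γ a : ℝ} {z₀ C₀ C₁ : ℂ} {T : ℂ → ℂ}
    (hT : T = piecewiseRotation α γ z₀ C₀ C₁)
    (h_line : (0 : ℂ) ∈ discontinuityLine γ z₀) (hα : α = 2 * Real.pi * a)
    {p : ℤ} {q : ℕ} (hq : 26 ≤ q) (hpq : IsCoprime p (q : ℤ))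
    (ha : |a - p / q| ≤ 1 / (q : ℝ) ^ 2) (hN : 0 < tripleNorm T) {z : ℂ}
    (hz : 2 / Real.pi * q ^ 2 * tripleNorm T ≤ ‖z‖) :
    |‖T^[q] z‖ - ‖z‖ + q / Real.pi * rotationDelta α γ C₀ C₁| ≤
      (8 + Real.pi / (2 * q)) * tripleNorm T + |rotationDelta α γ C₀ C₁| := by
  have hq0 : (0 : ℝ) < q := by exact_mod_cast (by omega : 0 < q)
  have hq26 : (26 : ℝ) ≤ q := by exact_mod_cast hq
  have hpi := Real.pi_gt_three
  have hpi' := Real.pi_lt_d4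
  set N := tripleNorm T with hNdef
  set v₀ := Complex.exp (-(γ : ℂ) * Complex.I) * rotationCoeff α C₀ with hv₀
  set v₁ := Complex.exp (-(γ : ℂ) * Complex.I) * rotationCoeff α C₁ with hv₁
  have hγ : ‖Complex.exp (-(γ : ℂ) * Complex.I)‖ = 1 := by
    have := Complex.norm_exp_ofReal_mul_I (-γ)
    simpa using this
  have hV := im_rotationCoeff_sub α γ C₀ C₁
  rw [← hv₀, ← hv₁] at hV
  have hw := norm_rotationCoeff_le_tripleNorm C₀ C₁ (α := α) h_line
  rw [← hT, ← hNdef] at hw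
  have h₀ : ‖v₀‖ ≤ N := by rw [hv₀, norm_mul, hγ, one_mul]; exact hw.1
  have h₁ : ‖v₁‖ ≤ N := by rw [hv₁, norm_mul, hγ, one_mul]; exact hw.2
  have h2pi : 0.6366 ≤ 2 / Real.pi := by rw [le_div_iff₀ (by linarith)]; linarith
  have hqsq : 26 * (q : ℝ) ≤ (q : ℝ) ^ 2 := by nlinarith
  -- 0.598 is just below 0.6366 - 1/26; below, 1.673 is chosen so that 1.673 · 0.598 ≥ 1.
  have hfar : 0.598 * (q : ℝ) ^ 2 * N ≤ 2 / Real.pi * q ^ 2 * N - q * N := by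
    have e1 : 0.6366 * (q : ℝ) ^ 2 * N ≤ 2 / Real.pi * q ^ 2 * N := by gcongr
    have e2 : 26 * (q : ℝ) * N ≤ (q : ℝ) ^ 2 * N := by gcongr
    have e3 : 0 < (q : ℝ) ^ 2 * N := by positivity
    linarith
  have hnorm : ∀ k < q, 2 / Real.pi * q ^ 2 * N - q * N ≤ ‖T^[k] z‖ - N := by
    intro k hk
    have h1 := abs_norm_iterate_sub_le α γ z₀ C₀ C₁ z k
    rw [← hT, ← hNdef] at h1
    have h2 : ((k : ℝ) + 1) * N ≤ q * N := by gcongr; exact_mod_cast hk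
    linarith [(abs_le.1 h1).1]
  have hbase : 0 < 0.598 * (q : ℝ) ^ 2 * N := by positivity
  set x : ℝ := 1.673 / (q : ℝ) ^ 2 with hx
  have hx0 : 0 < x := by positivity
  have hxsmall : x ≤ 0.0025 := by
    rw [hx, div_le_iff₀ (by positivity)]; nlinarith
  have hxN : ∀ k < q, N ≤ x * ‖T^[k] z‖ := by
    intro k hk
    have h1 := hnorm k hk
    calc N ≤ x * (0.598 * (q : ℝ) ^ 2 * N) := by
          rw [hx]
          have : 1.673 / (q : ℝ) ^ 2 * (0.598 * (q : ℝ) ^ 2 * N) = 1.673 * 0.598 * N := by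
            field_simp
          rw [this]; linarith
      _ ≤ x * ‖T^[k] z‖ := by gcongr; linarith
  obtain ⟨ψ, hψ⟩ := exists_angles_iterate h_line hv₀ hv₁ h₀ h₁ (by linarith : x < 1 / 2) hT z q
    (fun k hk => by linarith [hnorm k hk]) hxN
  have hη : ∀ k < q, |ψ (k + 1) - ψ k - α| ≤ 1.7 / (q : ℝ) ^ 2 := by
    intro k hk
    refine (hψ k hk).1.trans ?_
    have e1 : x ^ 2 ≤ 0.0025 * x := by nlinarith
    have e2 : 1.7 / (q : ℝ) ^ 2 = (1.7 / 1.673) * x := by rw [hx]; field_simp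
    rw [e2]
    nlinarith
  -- 8 = 1.7 + 6.3: the angular error of a step, plus 2π|a - p/q| ≤ 6.3/q².
  have hclose : ∀ k < q, |ψ k - (ψ (q / 2) + ((k : ℝ) - (q / 2 : ℕ)) * (2 * Real.pi * (p / q)))| ≤
      8 / (q : ℝ) ^ 2 * |(k : ℝ) - (q / 2 : ℕ)| := by
    intro k hk
    have h1 := abs_sub_sub_mul_le_of_abs_succ_sub_le hη hk.le (Nat.div_le_self q 2)
    have e : ψ k - (ψ (q / 2) + ((k : ℝ) - (q / 2 : ℕ)) * (2 * Real.pi * (p / q)))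
        = (ψ k - ψ (q / 2) - ((k : ℝ) - (q / 2 : ℕ)) * α)
          + ((k : ℝ) - (q / 2 : ℕ)) * (2 * Real.pi * (a - p / q)) := by rw [hα]; ring
    rw [e]
    refine (abs_add_le _ _).trans ?_
    have h2 : |((k : ℝ) - (q / 2 : ℕ)) * (2 * Real.pi * (a - p / q))|
        ≤ |(k : ℝ) - (q / 2 : ℕ)| * (6.3 * (1 / (q : ℝ) ^ 2)) := by
      rw [abs_mul, abs_mul, abs_of_pos (by linarith : 0 < 2 * Real.pi)]
      gcongr
      linarith
    refine (add_le_add h1 h2).trans (le_of_eq ?_)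
    ring
  have hsum := abs_sum_sectorWave_near_rotation_sub_le (by omega) hpq h₀ h₁ (ψ (q / 2)) ψ hclose
  have htel : ‖T^[q] z‖ - ‖z‖ = ∑ k ∈ Finset.range q, (‖T^[k + 1] z‖ - ‖T^[k] z‖) := by
    rw [Finset.sum_range_sub (fun k => ‖T^[k] z‖)]; simp
  have herr : |‖T^[q] z‖ - ‖z‖ - ∑ k ∈ Finset.range q, sectorWave v₀ v₁ (ψ k)| ≤
      Real.pi / (2 * q) * N := by
    rw [htel, ← Finset.sum_sub_distrib]
    refine (Finset.abs_sum_le_sum_abs _ _).trans ?_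
    have hb : ∀ k ∈ Finset.range q,
        |‖T^[k + 1] z‖ - ‖T^[k] z‖ - sectorWave v₀ v₁ (ψ k)| ≤ Real.pi / (2 * q) * N / q := by
      intro k hk
      have hk := Finset.mem_range.1 hk
      refine (hψ k hk).2.trans ?_
      have h1 := hnorm k hk
      have h3 : q ^ 2 * N ≤ Real.pi * (‖T^[k] z‖ - N) := by
        have e1 : Real.pi * (0.598 * (q : ℝ) ^ 2 * N) ≤ Real.pi * (‖T^[k] z‖ - N) := by
          gcongr; linarith
        nlinarith
      have e2 : Real.pi / (2 * q) * N / q = Real.pi * N / (2 * q ^ 2) := by field_simp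
      rw [e2, div_le_div_iff₀ (by linarith) (by positivity)]
      nlinarith
    refine (Finset.sum_le_sum hb).trans (le_of_eq ?_)
    rw [Finset.sum_const, Finset.card_range, nsmul_eq_mul]
    field_simp
  rw [hV, abs_neg] at hsum
  rw [abs_le] at *
  constructor <;> linarith

theorem exists_pos_drift {α γ a : ℝ} {z₀ C₀ C₁ : ℂ} {T : ℂ → ℂ}
    (hT : T = piecewiseRotation α γ z₀ C₀ C₁)
    (h_line : (0 : ℂ) ∈ discontinuityLine γ z₀) (hα : α = 2 * Real.pi * a)
    {p : ℤ} {q : ℕ} (hq : 0 < q) (hpq : IsCoprime p (q : ℤ))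
    (ha : |a - p / q| ≤ 1 / (q : ℝ) ^ 2) {Δ : ℝ} (hΔ : Δ = rotationDelta α γ C₀ C₁)
    (hl₀ : 1 / (q : ℝ) * ((8 + Real.pi / (2 * q)) * tripleNorm T + 4 * |Δ|) < |Δ| / Real.pi) :
    0 < tripleNorm T ∧ ∃ ε > 0, ∀ z : ℂ, 2 / Real.pi * q ^ 2 * tripleNorm T ≤ ‖z‖ →
      (0 < Δ → ‖T^[q] z‖ ≤ ‖z‖ - ε) ∧ (Δ < 0 → ‖z‖ + ε ≤ ‖T^[q] z‖) := by
  have hq0 : (0 : ℝ) < q := by exact_mod_cast hq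
  have hpi := Real.pi_gt_three
  have hw := norm_rotationCoeff_le_tripleNorm C₀ C₁ (α := α) h_line
  rw [← hT] at hw
  have hN0 : 0 ≤ tripleNorm T := (norm_nonneg _).trans hw.1
  have hΔN : |Δ| ≤ 2 * tripleNorm T := by
    rw [hΔ, ← abs_neg, ← im_rotationCoeff_sub α γ C₀ C₁]
    refine (Complex.abs_im_le_norm _).trans ((norm_sub_le _ _).trans ?_)
    have hγ : ‖Complex.exp (-(γ : ℂ) * Complex.I)‖ = 1 := by
      have := Complex.norm_exp_ofReal_mul_I (-γ)
      simpa using this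
    rw [norm_mul, norm_mul, hγ, one_mul, one_mul]
    linarith [hw.1, hw.2]
  have hl : (8 + Real.pi / (2 * q)) * tripleNorm T + 4 * |Δ| < q / Real.pi * |Δ| := by
    rw [one_div_mul_eq_div, div_lt_iff₀ hq0] at hl₀
    calc _ < |Δ| / Real.pi * q := hl₀
      _ = q / Real.pi * |Δ| := by ring
  have hfrac : 0 ≤ Real.pi / (2 * q) * tripleNorm T := by positivity
  have hΔ0 : 0 < |Δ| := by
    rcases (abs_nonneg Δ).eq_or_lt with h | h
    · rw [← h] at hl; nlinarith
    · exact h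
  have hq26 : 26 ≤ q := by
    -- Since |Δ| ≤ 2N, 8N + 4|Δ| ≥ 8|Δ|, so q > 8π > 25. The coefficient 4 serves here; the drift
    -- error itself involves only |Δ|.
    have h1 : 8 * |Δ| < q / Real.pi * |Δ| := by nlinarith
    have h2 : 8 < q / Real.pi := lt_of_mul_lt_mul_right h1 hΔ0.le
    rw [lt_div_iff₀ (by linarith)] at h2
    have h3 : (25 : ℝ) < q := by linarith [Real.pi_gt_d2]
    have h4 : 25 < q := by exact_mod_cast h3
    omega
  have hN : 0 < tripleNorm T := by linarith
  refine ⟨hN, q / Real.pi * |Δ| - ((8 + Real.pi / (2 * q)) * tripleNorm T + 4 * |Δ|), by linarith,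
    fun z hz => ?_⟩
  have h := abs_norm_iterate_sub_add_le hT h_line hα hq26 hpq ha hN hz
  rw [← hΔ] at h
  obtain ⟨h1, h2⟩ := abs_le.1 h
  constructor
  · intro hpos
    rw [abs_of_pos hpos] at *
    linarith
  · intro hneg
    rw [abs_of_neg hneg] at *
    linarith

/-! ### From drift to attraction and repulsion -/

/-- The ball of radius ρ + qN absorbs under T^q: a block starting below ρ adds at most qN, any other
loses ε. The n % q leftover steps are made first, so they cost only time and do not enlarge the
radius. -/
theorem eventually_norm_iterate_lt {T : ℂ → ℂ} {N ρ ε : ℝ} {q : ℕ} (hq : 0 < q) (hN : 0 < N)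
    (hε : 0 < ε) (hT : ∀ n z, |‖T^[n] z‖ - ‖z‖| ≤ n * N)
    (hdrift : ∀ z, ρ ≤ ‖z‖ → ‖T^[q] z‖ ≤ ‖z‖ - ε) (L : ℝ) :
    ∃ n₀ : ℕ, ∀ n ≥ n₀, ∀ z : ℂ, ‖z‖ ≤ L → ‖T^[n] z‖ < ρ + q * N := by
  have hqN : 0 < q * N := by positivity
  have hstep : ∀ (k : ℕ) (z : ℂ), ‖(T^[q])^[k] z‖ < ρ + q * N ∨ ‖(T^[q])^[k] z‖ ≤ ‖z‖ - k * ε := by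
    intro k z
    induction k with
    | zero => right; simp
    | succ k ih =>
      rw [Function.iterate_succ_apply']
      by_cases hρ : ρ ≤ ‖(T^[q])^[k] z‖
      · have h := hdrift _ hρ
        rcases ih with ih | ih
        · left; linarith
        · right; push_cast; linarith
      · left
        push Not at hρ
        linarith [(abs_le.1 (hT q ((T^[q])^[k] z))).2]
  obtain ⟨K, hK⟩ := exists_nat_gt ((L + q * N - (ρ + q * N)) / ε)
  rw [div_lt_iff₀ hε] at hK
  refine ⟨q * K, fun n hn z hz => ?_⟩
  have hdm := Nat.div_add_mod n q
  have hmod := Nat.mod_lt n hq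
  have hKn : K ≤ n / q := (Nat.le_div_iff_mul_le hq).2 (by linarith)
  rw [← hdm, Function.iterate_add_apply, Function.iterate_mul]
  have hz' : ‖T^[n % q] z‖ ≤ L + q * N := by
    have h1 := (abs_le.1 (hT (n % q) z)).2
    have h2 : ((n % q : ℕ) : ℝ) * N ≤ q * N := by gcongr
    linarith
  rcases hstep (n / q) (T^[n % q] z) with h | h
  · exact h
  · have h3 : (K : ℝ) * ε ≤ (n / q : ℕ) * ε := by gcongr
    linarith

/-- Here the margin qN pays for the leftover steps, made first: they end at norm at least ρ, and
every later block gains ε. -/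
theorem eventually_lt_norm_iterate {T : ℂ → ℂ} {N ρ ε : ℝ} {q : ℕ} (hq : 0 < q) (hN : 0 < N)
    (hε : 0 < ε) (hT : ∀ n z, |‖T^[n] z‖ - ‖z‖| ≤ n * N)
    (hdrift : ∀ z, ρ ≤ ‖z‖ → ‖z‖ + ε ≤ ‖T^[q] z‖) (L : ℝ) :
    ∃ n₀ : ℕ, ∀ n ≥ n₀, ∀ z : ℂ, ρ + q * N ≤ ‖z‖ → L < ‖T^[n] z‖ := by
  have hstep : ∀ (k : ℕ) (z : ℂ), ρ ≤ ‖z‖ → ρ + k * ε ≤ ‖(T^[q])^[k] z‖ := by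
    intro k z hz
    induction k with
    | zero => simpa using hz
    | succ k ih =>
      rw [Function.iterate_succ_apply']
      have h := hdrift _ (le_trans (by linarith [show 0 ≤ (k : ℝ) * ε by positivity]) ih)
      push_cast; linarith
  obtain ⟨K, hK⟩ := exists_nat_gt ((L - ρ) / ε)
  rw [div_lt_iff₀ hε] at hK
  refine ⟨q * K, fun n hn z hz => ?_⟩
  have hdm := Nat.div_add_mod n q
  have hmod := Nat.mod_lt n hq
  have hKn : K ≤ n / q := (Nat.le_div_iff_mul_le hq).2 (by linarith)
  rw [← hdm, Function.iterate_add_apply, Function.iterate_mul]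
  have hz' : ρ ≤ ‖T^[n % q] z‖ := by
    have h1 := (abs_le.1 (hT (n % q) z)).1
    have h2 : ((n % q : ℕ) : ℝ) * N ≤ q * N := by gcongr
    linarith
  have h := hstep (n / q) _ hz'
  have h3 : (K : ℝ) * ε ≤ (n / q : ℕ) * ε := by gcongr
  linarith

theorem isAttractingRadius_of_eventually {T : ℂ → ℂ} {R : ℝ≥0}
    (h : ∀ L : ℝ, ∃ n₀ : ℕ, ∀ n ≥ n₀, ∀ z : ℂ, ‖z‖ ≤ L → ‖T^[n] z‖ < R) :
    IsAttractingRadius T R := by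
  intro L
  obtain ⟨n₀, hn₀⟩ := h L
  apply limsup_le_of_le
  · isBoundedDefault
  · filter_upwards [eventually_ge_atTop n₀] with n hn
    refine iSup₂_le fun z hz => ?_
    rw [enorm_le_coe]
    exact_mod_cast (hn₀ n hn z hz).le

theorem isRepellingRadius_of_eventually {T : ℂ → ℂ} {R : ℝ≥0}
    (h : ∀ L : ℝ, ∃ n₀ : ℕ, ∀ n ≥ n₀, ∀ z : ℂ, R ≤ ‖z‖ → L < ‖T^[n] z‖) :
    IsRepellingRadius T R := by
  intro L hL
  refine ENNReal.eq_top_of_forall_nnreal_le fun K => ?_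
  obtain ⟨n₀, hn₀⟩ := h K
  apply le_liminf_of_le
  · isBoundedDefault
  · filter_upwards [eventually_ge_atTop n₀] with n hn
    refine le_iInf₂ fun z hz => ?_
    have := hn₀ n hn z (le_trans (by exact_mod_cast hL) hz)
    rw [← ofReal_norm, ← ENNReal.ofReal_coe_nnreal]
    exact ENNReal.ofReal_le_ofReal this.le

theorem attractorSet_subset_ball {T : ℂ → ℂ} {R : ℝ}
    (h : ∀ L : ℝ, ∃ n₀ : ℕ, ∀ n ≥ n₀, ∀ z : ℂ, ‖z‖ ≤ L → ‖T^[n] z‖ < R) :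
    attractorSet T ⊆ Metric.ball 0 R := by
  intro z hz
  simp only [attractorSet, mem_iUnion, mem_iInter] at hz
  obtain ⟨M, -, hM⟩ := hz
  obtain ⟨n₀, hn₀⟩ := h M
  obtain ⟨w, hw, rfl⟩ := hM n₀
  rw [mem_ball_zero_iff] at hw ⊢
  exact hn₀ n₀ le_rfl w hw.le

theorem boundedOrbitSet_subset_ball {T : ℂ → ℂ} {R : ℝ}
    (h : ∀ L : ℝ, ∃ n₀ : ℕ, ∀ n ≥ n₀, ∀ z : ℂ, R ≤ ‖z‖ → L < ‖T^[n] z‖) :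
    boundedOrbitSet T ⊆ Metric.ball 0 R := by
  intro z hz
  simp only [boundedOrbitSet, mem_iUnion, mem_iInter] at hz
  obtain ⟨M, -, hM⟩ := hz
  rw [mem_ball_zero_iff]
  by_contra hR
  push Not at hR
  obtain ⟨n₀, hn₀⟩ := h M
  have h1 := hn₀ n₀ le_rfl z hR
  have h2 := hM n₀
  rw [mem_preimage, mem_ball_zero_iff] at h2
  linarith

theorem mainTheorem1 (α γ a : ℝ) (z₀ C₀ C₁ : ℂ) (T : ℂ → ℂ)
    (hT : T = piecewiseRotation α γ z₀ C₀ C₁)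
    (h_line : (0 : ℂ) ∈ discontinuityLine γ z₀)
    (h_bij : ¬ Function.Bijective T)
    (hα : α = 2 * Real.pi * a) (ha : Irrational a)
    (l₀ : ℕ) (q Δ : ℝ) (hq : q = convergentDenom a l₀) (hΔ : Δ = rotationDelta α γ C₀ C₁)
    (hl₀ : 1 / q * ((8 + Real.pi / (2 * q)) * tripleNorm T + 4 * |Δ|) < |Δ| / Real.pi) :
    limitRadius T ≤ ENNReal.ofReal (boundRadius T q) ∧
    (0 < Δ → GloballyAttractive T ∧ attractorSet T ⊆ Metric.ball 0 (boundRadius T q)) ∧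
    (Δ < 0 → GloballyRepulsive T ∧ boundedOrbitSet T ⊆ Metric.ball 0 (boundRadius T q)) := by
  obtain ⟨p, m, hm, hpm, hden, happ⟩ := exists_coprime_convergentDenom ha l₀
  rw [hden] at hq
  subst hq
  obtain ⟨hN, ε, hε, hdrift⟩ := exists_pos_drift hT h_line hα hm hpm happ hΔ hl₀
  have hm0 : (0 : ℝ) < m := by exact_mod_cast hm
  have hpi := Real.pi_pos
  have hiter : ∀ (n : ℕ) (z : ℂ), |‖T^[n] z‖ - ‖z‖| ≤ n * tripleNorm T := by
    intro n z
    rw [hT]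
    exact abs_norm_iterate_sub_le α γ z₀ C₀ C₁ z n
  have hR : boundRadius T m = 2 / Real.pi * m ^ 2 * tripleNorm T + m * tripleNorm T := by
    unfold boundRadius; ring
  have hR0 : 0 ≤ boundRadius T m := by rw [hR]; positivity
  have hcoe : ((boundRadius T m).toNNReal : ℝ) = boundRadius T m := Real.coe_toNNReal _ hR0
  have hattr : 0 < Δ → ∀ L : ℝ, ∃ n₀ : ℕ, ∀ n ≥ n₀, ∀ z : ℂ, ‖z‖ ≤ L →
      ‖T^[n] z‖ < boundRadius T m := by
    intro hpos L
    rw [hR]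
    exact eventually_norm_iterate_lt hm hN hε hiter (fun z hz => (hdrift z hz).1 hpos) L
  have hrep : Δ < 0 → ∀ L : ℝ, ∃ n₀ : ℕ, ∀ n ≥ n₀, ∀ z : ℂ, boundRadius T m ≤ ‖z‖ →
      L < ‖T^[n] z‖ := by
    intro hneg L
    rw [hR]
    exact eventually_lt_norm_iterate hm hN hε hiter (fun z hz => (hdrift z hz).2 hneg) L
  have hattr' : 0 < Δ → IsAttractingRadius T (boundRadius T m).toNNReal := fun hpos =>
    isAttractingRadius_of_eventually (by rw [hcoe]; exact hattr hpos)
  have hrep' : Δ < 0 → IsRepellingRadius T (boundRadius T m).toNNReal := fun hneg =>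
    isRepellingRadius_of_eventually (by rw [hcoe]; exact hrep hneg)
  refine ⟨?_, fun hpos => ⟨⟨_, hattr' hpos⟩, attractorSet_subset_ball (hattr hpos)⟩,
    fun hneg => ⟨⟨_, hrep' hneg⟩, boundedOrbitSet_subset_ball (hrep hneg)⟩⟩
  have hΔ0 : Δ ≠ 0 := by
    rintro rfl
    rw [abs_zero, zero_div] at hl₀
    have : 0 ≤ 1 / (m : ℝ) * ((8 + Real.pi / (2 * m)) * tripleNorm T + 4 * 0) := by positivity
    linarith
  refine iInf₂_le (boundRadius T m).toNNReal ?_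
  rcases hΔ0.lt_or_gt with h | h
  · exact Or.inr (hrep' h)
  · exact Or.inl (hattr' h)
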